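/- Let $\Bbbk$ be a commutative ring and $n\ge 0$. Let $W=\mathcal S_n$ with simple reflections $S=\{s_1,\dots,s_{n-1}\}$, $s_j=(j\ \,j+1)$, and length function $\ell$. For $J\subseteq S$ let $W_J$ be the parabolic subgroup generated by $J$ and $w_J$ its longest element. An $(I,J)$-coset is an element $p$ of $W_I\backslash W/W_J$; $\overline p$ denotes its longest element. Let $*$ be the product on $W$ of the Coxeter monoid ($s*s=s$ for $s\in S$, and $x*y=xy$ if $\ell(xy)=\ell(x)+\ell(y)$). For an $(I,J)$-coset $p$ and a $(J,K)$-coset $q$, let $p*q$ be the $(I,K)$-coset containing $\overline p*\overline q$. It is called reduced if $\overline p*\overline q=(\overline p w_J^{-1})\,\overline q=\overline p\,(w_J^{-1}\overline q)$, with lengths adding up in both of the latter products. The nilCoxeter algebroid $\mathcal D(\mathcal S_n)$ is the $\Bbbk$-linear category whose objects are the subsets of $S$, in which $\mathrm{Hom}(J,I)$ is the free $\Bbbk$-module on symbols $\partial_p$, one for each $(I,J)$-coset $p$, and $\partial_p\circ\partial_q=\partial_{p*q}$ if $p*q$ is reduced, $\partial_p\circ\partial_q=0$ otherwise. An $(I,J)$-coset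 is atomic if there are $M\subseteq S$ and $s\in M$ such that, with $t=w_Msw_M$, one has $I=M\setminus\{s\}$, $J=M\setminus\{t\}$ and the coset contains $w_M$. Let $\mathcal{AD}(\mathcal S_n)$ be the $\Bbbk$-linear subcategory of $\mathcal D(\mathcal S_n)$ with the same objects that is generated by the $\partial_p$ with $p$ atomic. For $J\subseteq S$ with $S\setminus J=\{d_1<\dots<d_\ell\}$ (ordered by index) and $1\le i\le\ell$, let $s=d_i$, $M=J\cup\{s\}$, $t=w_Msw_M$, and let $\mathtt a_i^J$ be the atomic $(M\setminus\{t\},J)$-coset containing $w_M$. The labeled nilCoxeter algebroid $\mathcal{NC}(n)$ is the $\Bbbk$-linear category presented as follows. Its objects are the compositions $(n_1,\dots,n_k)$ of $n$ into positive parts. A composition is identified with the set $J\subseteq S$ of those $s_j$ for which $j$ and $j+1$ lie in the same block, so that $W_J=\mathcal S_{n_1}\times\dots\times\mathcal S_{n_k}$. The generating morphisms are the crossings $$\partial_i^J:(n_1,\dots,n_i,n_{i+1},\dots,n_k)\to(n_1,\dots,n_{i+1},n_i,\dots,n_k),\qquad 1\le i\le k-1,$$ where $J$ corresponds to the source. The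 relations, for every source $J$ (the remaining superscripts being determined), are $$\partial_i\partial_{i+1}\partial_i^J=\partial_{i+1}\partial_i\partial_{i+1}^J\ (1\le i\le k-2),\qquad \partial_i\partial_j^J=\partial_j\partial_i^J\ (|i-j|>1),\qquad \partial_i\partial_i^J=0\ (1\le i\le k-1).$$ Then there is an isomorphism of $\Bbbk$-linear categories (a $\Bbbk$-linear functor that is bijective on objects and on all morphism spaces) $$\psi:\mathcal{NC}(n)\xrightarrow{\ \sim\ }\mathcal{AD}(\mathcal S_n)$$ that sends each composition to the corresponding subset $J\subseteq S$ and satisfies $\psi(\partial_i^J)=\partial_{\mathtt a_i^J}$ for all $J$ and $i$. -/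

import Mathlib

open CategoryTheory

universe u v

/-! ## Linear categories presented by generators and relations -/

/-- Objects of the `R`-linear category presented by the quiver `V` of generating morphisms, with
the elements of `rel a b` (linear combinations of paths from `a` to `b`) imposed to vanish. -/
structure Presented (R : Type u) [CommRing R] (V : Type) [Quiver.{0} V]
    (rel : ∀ a b : V, Set (Quiver.Path a b →₀ R)) where
  vertex : V

namespace Presented

noncomputable section

variable {R : Type u} [CommRing R] {V : Type} [Quiver.{0} V]

/-- Bilinear concatenation of linear combinations of paths. -/
def pathComp (R : Type u) [CommRing R] {V : Type} [Quiver.{0} V] (a b c : V) :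
    (Quiver.Path a b →₀ R) →ₗ[R] (Quiver.Path b c →₀ R) →ₗ[R] (Quiver.Path a c →₀ R) :=
  Finsupp.linearCombination R fun p =>
    Finsupp.linearCombination R fun q => Finsupp.single (p.comp q) (1 : R)

lemma pathComp_single {a b c : V} (p : Quiver.Path a b) (q : Quiver.Path b c) :
    pathComp R a b c (Finsupp.single p 1) (Finsupp.single q 1) = Finsupp.single (p.comp q) 1 := by
  simp [pathComp]

lemma pathComp_assoc {a b c d : V} (f : Quiver.Path a b →₀ R) (g : Quiver.Path b c →₀ R)
    (h : Quiver.Path c d →₀ R) :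
    pathComp R a c d (pathComp R a b c f g) h = pathComp R a b d f (pathComp R b c d g h) := by
  induction f using Finsupp.induction_linear with
  | zero => simp
  | add f₁ f₂ h₁ h₂ => simp [h₁, h₂]
  | single p r =>
    induction g using Finsupp.induction_linear with
    | zero => simp
    | add f₁ f₂ h₁ h₂ => simp only [map_add, LinearMap.add_apply, h₁, h₂]
    | single q s =>
      induction h using Finsupp.induction_linear with
      | zero => simp
      | add f₁ f₂ h₁ h₂ => simp only [map_add, h₁, h₂]
      | single q' s' =>
        simp only [pathComp, Finsupp.linearCombination_single, LinearMap.smul_apply,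
          Finsupp.smul_single, smul_eq_mul, mul_one, mul_assoc, Quiver.Path.comp_assoc]

lemma pathComp_nil_left {a b : V} (f : Quiver.Path a b →₀ R) :
    pathComp R a a b (Finsupp.single Quiver.Path.nil 1) f = f := by
  induction f using Finsupp.induction_linear with
  | zero => simp
  | add f₁ f₂ h₁ h₂ => simp [h₁, h₂]
  | single p r => simp [pathComp]

lemma pathComp_nil_right {a b : V} (f : Quiver.Path a b →₀ R) :
    pathComp R a b b f (Finsupp.single Quiver.Path.nil 1) = f := by
  induction f using Finsupp.induction_linear with
  | zero => simp
  | add f₁ f₂ h₁ h₂ => simp [h₁, h₂]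
  | single p r => simp [pathComp]

/-- The two-sided ideal generated by the relators. -/
def ideal (rel : ∀ a b : V, Set (Quiver.Path a b →₀ R)) (a b : V) :
    Submodule R (Quiver.Path a b →₀ R) :=
  Submodule.span R {x | ∃ (c d : V) (f : Quiver.Path a c →₀ R) (y : Quiver.Path c d →₀ R)
    (g : Quiver.Path d b →₀ R), y ∈ rel c d ∧
      x = pathComp R a d b (pathComp R a c d f y) g}

variable {rel : ∀ a b : V, Set (Quiver.Path a b →₀ R)}

lemma comp_mem_ideal_left {a b c : V} (f : Quiver.Path a b →₀ R) {g : Quiver.Path b c →₀ R}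
    (hg : g ∈ ideal rel b c) : pathComp R a b c f g ∈ ideal rel a c := by
  induction hg using Submodule.span_induction with
  | mem x hx =>
    obtain ⟨c', d', k, y, l, hy, rfl⟩ := hx
    refine Submodule.subset_span ⟨c', d', pathComp R _ _ _ f k, y, l, hy, ?_⟩
    simp only [pathComp_assoc]
  | zero => simp
  | add x y _ _ hx hy => rw [map_add]; exact Submodule.add_mem _ hx hy
  | smul r x _ hx => rw [map_smul]; exact Submodule.smul_mem _ _ hx

lemma comp_mem_ideal_right {a b c : V} {f : Quiver.Path a b →₀ R} (g : Quiver.Path b c →₀ R)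
    (hf : f ∈ ideal rel a b) : pathComp R a b c f g ∈ ideal rel a c := by
  induction hf using Submodule.span_induction with
  | mem x hx =>
    obtain ⟨c', d', k, y, l, hy, rfl⟩ := hx
    refine Submodule.subset_span ⟨c', d', k, y, pathComp R _ _ _ l g, hy, ?_⟩
    simp only [pathComp_assoc]
  | zero => simp
  | add x y _ _ hx hy => rw [map_add, LinearMap.add_apply]; exact Submodule.add_mem _ hx hy
  | smul r x _ hx => rw [map_smul, LinearMap.smul_apply]; exact Submodule.smul_mem _ _ hx

/-- Morphisms: linear combinations of paths modulo the ideal of relations. -/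
def Hom (X Y : Presented R V rel) : Type u :=
  (Quiver.Path X.vertex Y.vertex →₀ R) ⧸ ideal rel X.vertex Y.vertex

instance (X Y : Presented R V rel) : AddCommGroup (Hom X Y) :=
  inferInstanceAs (AddCommGroup ((Quiver.Path X.vertex Y.vertex →₀ R) ⧸ ideal rel _ _))

instance (X Y : Presented R V rel) : Module R (Hom X Y) :=
  inferInstanceAs (Module R ((Quiver.Path X.vertex Y.vertex →₀ R) ⧸ ideal rel _ _))

/-- The class of a linear combination of paths. -/
def toHom (X Y : Presented R V rel) : (Quiver.Path X.vertex Y.vertex →₀ R) →ₗ[R] Hom X Y :=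
  (ideal rel X.vertex Y.vertex).mkQ

lemma toHom_surjective (X Y : Presented R V rel) : Function.Surjective (toHom X Y) :=
  (ideal rel X.vertex Y.vertex).mkQ_surjective

lemma toHom_eq_zero_iff {X Y : Presented R V rel} {x : Quiver.Path X.vertex Y.vertex →₀ R} :
    toHom X Y x = 0 ↔ x ∈ ideal rel X.vertex Y.vertex :=
  Submodule.Quotient.mk_eq_zero _

/-- Bilinear composition of morphisms. -/
def homComp (X Y Z : Presented R V rel) : Hom X Y →ₗ[R] Hom Y Z →ₗ[R] Hom X Z :=
  (ideal rel X.vertex Y.vertex).liftQ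
    { toFun := fun f => (ideal rel Y.vertex Z.vertex).liftQ
        ((toHom X Z).comp (pathComp R X.vertex Y.vertex Z.vertex f))
        (fun _ hg => toHom_eq_zero_iff.2 (comp_mem_ideal_left f hg))
      map_add' := fun f₁ f₂ => by
        apply Submodule.linearMap_qext
        refine LinearMap.ext fun g => ?_
        change toHom X Z (pathComp R _ _ _ (f₁ + f₂) g) =
          toHom X Z (pathComp R _ _ _ f₁ g) + toHom X Z (pathComp R _ _ _ f₂ g)
        rw [map_add, LinearMap.add_apply, map_add]
      map_smul' := fun r f => by
        apply Submodule.linearMap_qext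
        refine LinearMap.ext fun g => ?_
        change toHom X Z (pathComp R _ _ _ (r • f) g) = r • toHom X Z (pathComp R _ _ _ f g)
        rw [map_smul, LinearMap.smul_apply, map_smul] }
    (fun f hf => by
      apply Submodule.linearMap_qext
      refine LinearMap.ext fun g => ?_
      exact toHom_eq_zero_iff.2 (comp_mem_ideal_right g hf))

lemma homComp_toHom {X Y Z : Presented R V rel} (f : Quiver.Path X.vertex Y.vertex →₀ R)
    (g : Quiver.Path Y.vertex Z.vertex →₀ R) :
    homComp X Y Z (toHom X Y f) (toHom Y Z g) = toHom X Z (pathComp R _ _ _ f g) := rfl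

instance : Category.{u} (Presented R V rel) where
  Hom X Y := Hom X Y
  id X := toHom X X (Finsupp.single Quiver.Path.nil 1)
  comp {X Y Z} f g := homComp X Y Z f g
  id_comp {X Y} f := by
    obtain ⟨f, rfl⟩ := toHom_surjective X Y f
    rw [homComp_toHom, pathComp_nil_left]
  comp_id {X Y} f := by
    obtain ⟨f, rfl⟩ := toHom_surjective X Y f
    rw [homComp_toHom, pathComp_nil_right]
  assoc {W X Y Z} f g h := by
    obtain ⟨f, rfl⟩ := toHom_surjective W X f
    obtain ⟨g, rfl⟩ := toHom_surjective X Y g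
    obtain ⟨h, rfl⟩ := toHom_surjective Y Z h
    simp only [homComp_toHom, pathComp_assoc]

instance : Preadditive (Presented R V rel) where
  homGroup X Y := inferInstanceAs (AddCommGroup (Hom X Y))
  add_comp X Y Z f f' g := LinearMap.map_add₂ (homComp X Y Z) f f' g
  comp_add X Y Z f g g' := (homComp X Y Z f).map_add g g'

instance : Linear R (Presented R V rel) where
  homModule X Y := inferInstanceAs (Module R (Hom X Y))
  smul_comp X Y Z r f g := LinearMap.map_smul₂ (homComp X Y Z) r f g
  comp_smul X Y Z f r g := (homComp X Y Z f).map_smul r g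

/-- The morphism given by a generator. -/
def gen {X Y : Presented R V rel} (e : X.vertex ⟶ Y.vertex) : X ⟶ Y :=
  toHom X Y (Finsupp.single e.toPath 1)

end

end Presented

/-! ## Linear subcategories generated by a class of morphisms -/

/-- Objects of the `R`-linear subcategory of `C`, containing all objects, that is generated by the
morphisms in `P`. -/
structure GeneratedSubcategory (R : Type u) [CommRing R] {C : Type} [Category.{u} C]
    [Preadditive C] [Linear R C] (P : MorphismProperty C) where
  obj : C

namespace GeneratedSubcategory

variable {R : Type u} [CommRing R] {C : Type} [Category.{u} C] [Preadditive C] [Linear R C]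

/-- The morphisms obtained from `P` and the identities by composition and `R`-linear
combination. -/
inductive Mem (R : Type u) [CommRing R] {C : Type} [Category.{u} C] [Preadditive C] [Linear R C]
    (P : MorphismProperty C) : ∀ {X Y : C}, (X ⟶ Y) → Prop
  | of {X Y : C} (f : X ⟶ Y) : P f → Mem R P f
  | id (X : C) : Mem R P (𝟙 X)
  | comp {X Y Z : C} (f : X ⟶ Y) (g : Y ⟶ Z) : Mem R P f → Mem R P g → Mem R P (f ≫ g)
  | zero (X Y : C) : Mem R P (0 : X ⟶ Y)
  | add {X Y : C} (f g : X ⟶ Y) : Mem R P f → Mem R P g → Mem R P (f + g)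
  | smul {X Y : C} (r : R) (f : X ⟶ Y) : Mem R P f → Mem R P (r • f)

/-- The submodule of morphisms `X ⟶ Y` lying in the generated subcategory. -/
def homs (R : Type u) [CommRing R] {C : Type} [Category.{u} C] [Preadditive C] [Linear R C]
    (P : MorphismProperty C) (X Y : C) : Submodule R (X ⟶ Y) where
  carrier := {f | Mem R P f}
  add_mem' := Mem.add _ _
  zero_mem' := Mem.zero _ _
  smul_mem' r f := Mem.smul r f

variable {P : MorphismProperty C}

instance : Category.{u} (GeneratedSubcategory R P) where
  Hom X Y := homs R P X.obj Y.obj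
  id X := ⟨𝟙 X.obj, Mem.id _⟩
  comp f g := ⟨f.1 ≫ g.1, Mem.comp _ _ f.2 g.2⟩
  id_comp f := Subtype.ext (Category.id_comp f.1)
  comp_id f := Subtype.ext (Category.comp_id f.1)
  assoc f g h := Subtype.ext (Category.assoc f.1 g.1 h.1)

instance : Preadditive (GeneratedSubcategory R P) where
  homGroup X Y := inferInstanceAs (AddCommGroup (homs R P X.obj Y.obj))
  add_comp _ _ _ f f' g := Subtype.ext (Preadditive.add_comp _ _ _ f.1 f'.1 g.1)
  comp_add _ _ _ f g g' := Subtype.ext (Preadditive.comp_add _ _ _ f.1 g.1 g'.1)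

instance : Linear R (GeneratedSubcategory R P) where
  homModule X Y := inferInstanceAs (Module R (homs R P X.obj Y.obj))
  smul_comp _ _ _ r f g := Subtype.ext (Linear.smul_comp _ _ _ r f.1 g.1)
  comp_smul _ _ _ f r g := Subtype.ext (Linear.comp_smul _ _ _ f.1 r g.1)

/-- The inclusion functor. -/
def incl (R : Type u) [CommRing R] {C : Type} [Category.{u} C] [Preadditive C] [Linear R C]
    (P : MorphismProperty C) : GeneratedSubcategory R P ⥤ C where
  obj X := X.obj
  map f := f.1

end GeneratedSubcategory

/-! ## The symmetric group as a Coxeter group -/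

namespace TypeA

noncomputable section

variable {n : ℕ}

/-- The smaller of the two consecutive letters exchanged by the `i`-th simple reflection. -/
def lo (i : Fin (n - 1)) : Fin n := ⟨i, by have := i.2; omega⟩

/-- The larger of the two consecutive letters exchanged by the `i`-th simple reflection. -/
def hi (i : Fin (n - 1)) : Fin n := ⟨i + 1, by have := i.2; omega⟩

/-- The simple reflections of `S_n`, indexed by `Fin (n - 1)`. -/
def simple (i : Fin (n - 1)) : Equiv.Perm (Fin n) := Equiv.swap (lo i) (hi i)

/-- Coxeter length: the number of inversions. -/
def len (w : Equiv.Perm (Fin n)) : ℕ :=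
  (Finset.univ.filter fun q : Fin n × Fin n => q.1 < q.2 ∧ w q.2 < w q.1).card

lemma lo_lt_hi (i : Fin (n - 1)) : lo i < hi i := by
  simp [lo, hi, Fin.lt_def]

lemma simple_mul_self (i : Fin (n - 1)) : simple i * simple i = 1 := by
  simp [simple]

lemma simple_mul_simple_mul (i : Fin (n - 1)) (w : Equiv.Perm (Fin n)) :
    simple i * (simple i * w) = w := by
  rw [← mul_assoc, simple_mul_self, one_mul]

lemma mul_simple_mul_simple (i : Fin (n - 1)) (w : Equiv.Perm (Fin n)) :
    w * simple i * simple i = w := by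
  rw [mul_assoc, simple_mul_self, mul_one]

lemma simple_inv (i : Fin (n - 1)) : (simple i)⁻¹ = simple i := by
  simp [simple]

lemma simple_lo (i : Fin (n - 1)) : simple i (lo i) = hi i := by simp [simple]

lemma simple_hi (i : Fin (n - 1)) : simple i (hi i) = lo i := by simp [simple]

lemma simple_lt {i : Fin (n - 1)} {a b : Fin n} (h : a < b) (h' : ¬ (a = lo i ∧ b = hi i)) :
    simple i a < simple i b := by
  simp only [simple, Equiv.swap_apply_def]
  split_ifs <;> simp only [lo, hi, Fin.ext_iff, Fin.lt_def] at * <;> omega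

lemma len_mul_simple {i : Fin (n - 1)} {w : Equiv.Perm (Fin n)} (h : w (lo i) < w (hi i)) :
    len (w * simple i) = len w + 1 := by
  classical
  have key : (Finset.univ.filter fun q : Fin n × Fin n =>
      q.1 < q.2 ∧ (w * simple i) q.2 < (w * simple i) q.1) =
      insert (lo i, hi i) ((Finset.univ.filter fun q : Fin n × Fin n =>
        q.1 < q.2 ∧ w q.2 < w q.1).map (Equiv.prodCongr (simple i) (simple i)).toEmbedding) := by
    ext ⟨a, b⟩
    have hs : (simple i).symm = simple i := simple_inv i
    rw [Finset.mem_filter, Finset.mem_insert, Finset.mem_map_equiv, Finset.mem_filter]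
    simp only [Finset.mem_univ, true_and, Prod.mk.injEq, Equiv.prodCongr_symm,
      Equiv.prodCongr_apply, Prod.map, Equiv.Perm.mul_apply, hs]
    constructor
    · rintro ⟨hab, hw⟩
      by_cases hc : a = lo i ∧ b = hi i
      · exact Or.inl hc
      · exact Or.inr ⟨simple_lt hab hc, hw⟩
    · rintro (⟨rfl, rfl⟩ | ⟨hab, hw⟩)
      · rw [simple_lo, simple_hi]
        exact ⟨lo_lt_hi i, h⟩
      · refine ⟨?_, hw⟩
        have hc : ¬ (simple i a = lo i ∧ simple i b = hi i) := by
          rintro ⟨h1, h2⟩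
          rw [h1, h2] at hw
          exact absurd hw (not_lt.2 h.le)
        have := simple_lt hab hc
        have e : ∀ x, simple i (simple i x) = x := fun x => by
          rw [← Equiv.Perm.mul_apply, simple_mul_self, Equiv.Perm.one_apply]
        rwa [e, e] at this
  unfold len
  rw [key, Finset.card_insert_of_notMem, Finset.card_map]
  simp only [Finset.mem_map_equiv, Equiv.prodCongr_symm, Equiv.prodCongr_apply, Prod.map,
    Finset.mem_filter, not_and]
  have hs : (simple i).symm = simple i := simple_inv i
  rw [hs, simple_lo, simple_hi]
  intro _ h'
  exact absurd h' (not_lt.2 (lo_lt_hi i).le)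

lemma len_inv (w : Equiv.Perm (Fin n)) : len w⁻¹ = len w := by
  unfold len
  refine Finset.card_bij' (fun q _ => (w⁻¹ q.2, w⁻¹ q.1)) (fun q _ => (w q.2, w q.1)) ?_ ?_ ?_ ?_
  · rintro ⟨a, b⟩ h
    simpa [and_comm] using h
  · rintro ⟨a, b⟩ h
    simpa [and_comm] using h
  · rintro ⟨a, b⟩ h
    simp
  · rintro ⟨a, b⟩ h
    simp

lemma len_simple_mul {i : Fin (n - 1)} {w : Equiv.Perm (Fin n)} (h : w⁻¹ (lo i) < w⁻¹ (hi i)) :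
    len (simple i * w) = len w + 1 := by
  have := len_mul_simple h
  rwa [len_inv, ← len_inv, mul_inv_rev, inv_inv, simple_inv] at this

lemma ascR_iff {i : Fin (n - 1)} {w : Equiv.Perm (Fin n)} :
    len w < len (w * simple i) ↔ w (lo i) < w (hi i) := by
  refine ⟨fun h => ?_, fun h => by rw [len_mul_simple h]; omega⟩
  by_contra h'
  have hne : w (hi i) ≠ w (lo i) := fun e => (lo_lt_hi i).ne' (w.injective e)
  have h2 : (w * simple i) (lo i) < (w * simple i) (hi i) := by
    rw [Equiv.Perm.mul_apply, Equiv.Perm.mul_apply, simple_lo, simple_hi]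
    exact lt_of_le_of_ne (not_lt.1 h') hne
  have := len_mul_simple h2
  rw [mul_simple_mul_simple] at this
  omega

lemma ascL_iff {i : Fin (n - 1)} {w : Equiv.Perm (Fin n)} :
    len w < len (simple i * w) ↔ w⁻¹ (lo i) < w⁻¹ (hi i) := by
  rw [← ascR_iff, len_inv, ← len_inv (simple i * w), mul_inv_rev, simple_inv]

lemma len_ascR {i : Fin (n - 1)} {w : Equiv.Perm (Fin n)} (h : len w < len (w * simple i)) :
    len (w * simple i) = len w + 1 := len_mul_simple (ascR_iff.1 h)

lemma len_ascL {i : Fin (n - 1)} {w : Equiv.Perm (Fin n)} (h : len w < len (simple i * w)) :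
    len (simple i * w) = len w + 1 := len_simple_mul (ascL_iff.1 h)

lemma len_descR {i : Fin (n - 1)} {w : Equiv.Perm (Fin n)} (h : ¬ len w < len (w * simple i)) :
    len w = len (w * simple i) + 1 := by
  have h1 : len (w * simple i) < len (w * simple i * simple i) := by
    rw [ascR_iff] at h ⊢
    have hne : w (hi i) ≠ w (lo i) := fun e => (lo_lt_hi i).ne' (w.injective e)
    rw [Equiv.Perm.mul_apply, Equiv.Perm.mul_apply, simple_lo, simple_hi]
    exact lt_of_le_of_ne (not_lt.1 h) hne
  have := len_ascR h1
  rwa [mul_simple_mul_simple] at this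

lemma len_descL {i : Fin (n - 1)} {w : Equiv.Perm (Fin n)} (h : ¬ len w < len (simple i * w)) :
    len w = len (simple i * w) + 1 := by
  rw [← len_inv w, ← len_inv (simple i * w), mul_inv_rev, simple_inv] at h ⊢
  exact len_descR h

/-- A permutation other than the identity has a right descent. -/
lemma exists_descR {w : Equiv.Perm (Fin n)} (hw : w ≠ 1) :
    ∃ i : Fin (n - 1), w (hi i) < w (lo i) := by
  by_contra! h
  apply hw
  have hmono : StrictMono w := by
    have hlt : ∀ i : Fin (n - 1), w (lo i) < w (hi i) := fun i =>
      lt_of_le_of_ne (h i) fun e => (lo_lt_hi i).ne (w.injective e)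
    have aux : ∀ (k : ℕ) (a b : Fin n), (b : ℕ) = a + k + 1 → w a < w b := by
      intro k
      induction k with
      | zero =>
        intro a b hab
        have hb := b.2
        have := hlt ⟨a, by omega⟩
        have e : hi (⟨a, by omega⟩ : Fin (n - 1)) = b := by
          apply Fin.ext; simp [hi]; omega
        rw [e] at this
        exact this
      | succ k ih =>
        intro a b hab
        have hb := b.2
        have := hlt ⟨a + k + 1, by omega⟩
        have e : hi (⟨a + k + 1, by omega⟩ : Fin (n - 1)) = b := by
          apply Fin.ext; simp [hi]; omega
        rw [e] at this
        exact (ih a _ rfl).trans this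
    intro a b hab
    exact aux (b - a - 1) a b (by have := Fin.lt_def.1 hab; omega)
  have hid : ∀ a, w a = a := by
    have e : (hmono.orderIsoOfSurjective w w.surjective) = OrderIso.refl (Fin n) :=
      Subsingleton.elim _ _
    intro a
    exact congrArg (fun f : Fin n ≃o Fin n => f a) e
  exact Equiv.ext hid

lemma len_one : len (1 : Equiv.Perm (Fin n)) = 0 := by
  simp only [len, Finset.card_eq_zero, Finset.filter_eq_empty_iff]
  rintro ⟨a, b⟩ - ⟨h1, h2⟩
  exact absurd h1 (not_lt.2 h2.le)

lemma exists_reduced_word (w : Equiv.Perm (Fin n)) :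
    ∃ l : List (Fin (n - 1)), (l.map simple).prod = w ∧ l.length = len w := by
  induction hk : len w generalizing w with
  | zero =>
    refine ⟨[], ?_, rfl⟩
    by_contra hne
    have hne : w ≠ 1 := fun e => hne (by simp [e])
    obtain ⟨i, hi'⟩ := exists_descR hne
    have := len_descR (i := i) (w := w) (by rw [ascR_iff]; exact not_lt.2 hi'.le)
    omega
  | succ k ih =>
    have hne : w⁻¹ ≠ 1 := by
      intro e
      rw [inv_eq_one] at e
      rw [e, len_one] at hk
      omega
    obtain ⟨i, hi'⟩ := exists_descR hne
    have := len_descL (i := i) (w := w) (by rw [ascL_iff]; exact not_lt.2 hi'.le)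
    obtain ⟨l, hl, hl'⟩ := ih (simple i * w) (by omega)
    refine ⟨i :: l, ?_, by simp [hl']⟩
    rw [List.map_cons, List.prod_cons, hl, simple_mul_simple_mul]

/-! ### The Coxeter monoid -/

/-- Multiplication `s_i * w` by a generator in the Coxeter monoid, transported to `S_n`. -/
def starLeft (i : Fin (n - 1)) (w : Equiv.Perm (Fin n)) : Equiv.Perm (Fin n) :=
  if len w < len (simple i * w) then simple i * w else w

/-- Right multiplication `w * s_i` by a generator in the Coxeter monoid. -/
def starRight (i : Fin (n - 1)) (w : Equiv.Perm (Fin n)) : Equiv.Perm (Fin n) :=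
  if len w < len (w * simple i) then w * simple i else w

/-- A reduced expression of `w`. -/
def reducedWord (w : Equiv.Perm (Fin n)) : List (Fin (n - 1)) := (exists_reduced_word w).choose

/-- The product of the Coxeter monoid `(S_n, *)`, i.e. `s_1 * (s_2 * ⋯ (s_k * y))` for a reduced
expression `x = s_1 s_2 ⋯ s_k`. By `star_assoc`, `one_star`, `star_one`, `simple_star` and
`star_eq_mul_of_len'` below this is the monoid structure on `S_n` with `x * y = x y` whenever
lengths add up and `s_i * s_i = s_i`. -/
def star (x y : Equiv.Perm (Fin n)) : Equiv.Perm (Fin n) := (reducedWord x).foldr starLeft y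

lemma starLeft_starRight (i j : Fin (n - 1)) (w : Equiv.Perm (Fin n)) :
    starLeft i (starRight j w) = starRight j (starLeft i w) := by
  by_cases hL : len w < len (simple i * w) <;> by_cases hR : len w < len (w * simple j)
  · have eL : starLeft i w = simple i * w := if_pos hL
    have eR : starRight j w = w * simple j := if_pos hR
    rw [eL, eR]
    unfold starLeft starRight
    have h1 := len_ascL hL
    have h2 := len_ascR hR
    rw [← mul_assoc]
    by_cases h : len (w * simple j) < len (simple i * w * simple j)
    · rw [if_pos h, if_pos (by omega)]
    · rw [if_neg h, if_neg (by omega)]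
      have h3 : ¬ len (simple i * w) < len (simple i * w * simple j) := by omega
      rw [ascR_iff] at h3 hR
      have h4 : w (lo j) = lo i ∧ w (hi j) = hi i := by
        by_contra hc
        exact h3 (simple_lt hR hc)
      have h5 : simple i = w * simple j * w⁻¹ := by
        rw [simple, simple, ← h4.1, ← h4.2]
        exact (Equiv.mul_swap_eq_swap_mul w (lo j) (hi j) ▸ by simp)
      rw [h5, inv_mul_cancel_right]
  · have eL : starLeft i w = simple i * w := if_pos hL
    have eR : starRight j w = w := if_neg hR
    rw [eL, eR, eL]
    have h2 := len_descR hR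
    have h1 := len_ascL hL
    have h3 : len (simple i * (w * simple j)) ≤ len (w * simple j) + 1 := by
      by_cases h : len (w * simple j) < len (simple i * (w * simple j))
      · rw [len_ascL h]
      · omega
    rw [← mul_assoc] at h3
    exact (if_neg (by omega)).symm
  · have eL : starLeft i w = w := if_neg hL
    have eR : starRight j w = w * simple j := if_pos hR
    rw [eL, eR]
    have h2 := len_descL hL
    have h1 := len_ascR hR
    have h3 : len (simple i * w * simple j) ≤ len (simple i * w) + 1 := by
      by_cases h : len (simple i * w) < len (simple i * w * simple j)
      · rw [len_ascR h]
      · omega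
    rw [mul_assoc] at h3
    exact if_neg (by omega)
  · have eL : starLeft i w = w := if_neg hL
    have eR : starRight j w = w := if_neg hR
    rw [eL, eR, eL]

lemma len_starLeft_le (i : Fin (n - 1)) (w : Equiv.Perm (Fin n)) :
    len (starLeft i w) ≤ len w + 1 := by
  unfold starLeft
  split_ifs with h
  · rw [len_ascL h]
  · omega

lemma len_simple_mul_le (i : Fin (n - 1)) (w : Equiv.Perm (Fin n)) :
    len (simple i * w) ≤ len w + 1 := by
  by_cases h : len w < len (simple i * w)
  · rw [len_ascL h]
  · omega

lemma foldr_le (l : List (Fin (n - 1))) (y : Equiv.Perm (Fin n)) :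
    len (l.foldr starLeft y) ≤ l.length + len y := by
  induction l with
  | nil => simp
  | cons i l ih =>
    have := len_starLeft_le i (l.foldr starLeft y)
    simp only [List.foldr_cons, List.length_cons]
    omega

lemma foldr_eq_of_len (l : List (Fin (n - 1))) (y : Equiv.Perm (Fin n))
    (h : len (l.foldr starLeft y) = l.length + len y) :
    l.foldr starLeft y = (l.map simple).prod * y := by
  induction l with
  | nil => simp
  | cons i l ih =>
    simp only [List.foldr_cons, List.length_cons, List.map_cons, List.prod_cons] at h ⊢
    have h1 := len_starLeft_le i (l.foldr starLeft y)
    have h2 := foldr_le l y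
    have h3 := ih (by omega)
    rw [mul_assoc, ← h3]
    generalize l.foldr starLeft y = z at *
    unfold starLeft at h ⊢
    split_ifs at h ⊢ with h4
    · rfl
    · omega

lemma prod_mul_le (l : List (Fin (n - 1))) (y : Equiv.Perm (Fin n)) :
    len ((l.map simple).prod * y) ≤ l.length + len y := by
  induction l with
  | nil => simp
  | cons i l ih =>
    have := len_simple_mul_le i ((l.map simple).prod * y)
    simp only [List.map_cons, List.prod_cons, List.length_cons, mul_assoc]
    omega

lemma foldr_eq_of_len' (l : List (Fin (n - 1))) (y : Equiv.Perm (Fin n))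
    (h : len ((l.map simple).prod * y) = l.length + len y) :
    l.foldr starLeft y = (l.map simple).prod * y := by
  induction l with
  | nil => simp
  | cons i l ih =>
    simp only [List.foldr_cons, List.length_cons, List.map_cons, List.prod_cons, mul_assoc] at h ⊢
    have h1 := len_simple_mul_le i ((l.map simple).prod * y)
    have h2 := prod_mul_le l y
    rw [ih (by omega)]
    exact if_pos (by omega)

lemma foldr_reducedWord (w : Equiv.Perm (Fin n)) : (reducedWord w).foldr starLeft 1 = w := by
  obtain ⟨h1, h2⟩ := (exists_reduced_word w).choose_spec
  have := foldr_eq_of_len' (reducedWord w) 1 (by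
    rw [mul_one, len_one]
    exact (congrArg len h1).trans h2.symm)
  rw [this, mul_one]
  exact h1

lemma starLeft_inv (i : Fin (n - 1)) (w : Equiv.Perm (Fin n)) :
    (starLeft i w)⁻¹ = starRight i w⁻¹ := by
  unfold starLeft starRight
  rw [len_inv, ← len_inv (simple i * w), mul_inv_rev, simple_inv]
  split_ifs <;> simp [simple_inv]

lemma foldl_starRight (l : List (Fin (n - 1))) (w : Equiv.Perm (Fin n)) :
    l.reverse.foldl (fun x i => starRight i x) w⁻¹ = (l.foldr starLeft w)⁻¹ := by
  induction l with
  | nil => simp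
  | cons i l ih => simp [ih, starLeft_inv]

lemma exists_foldl (w : Equiv.Perm (Fin n)) :
    ∃ l : List (Fin (n - 1)), l.foldl (fun x i => starRight i x) 1 = w := by
  refine ⟨(reducedWord w⁻¹).reverse, ?_⟩
  have := foldl_starRight (reducedWord w⁻¹) 1
  rwa [foldr_reducedWord, inv_inv, inv_one] at this

lemma starLeft_foldl (i : Fin (n - 1)) (l : List (Fin (n - 1))) (w : Equiv.Perm (Fin n)) :
    starLeft i (l.foldl (fun x i => starRight i x) w) =
      l.foldl (fun x i => starRight i x) (starLeft i w) := by
  induction l generalizing w with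
  | nil => rfl
  | cons j l ih => simp [ih, starLeft_starRight]

lemma foldr_foldl (m l : List (Fin (n - 1))) (w : Equiv.Perm (Fin n)) :
    m.foldr starLeft (l.foldl (fun x i => starRight i x) w) =
      l.foldl (fun x i => starRight i x) (m.foldr starLeft w) := by
  induction m with
  | nil => rfl
  | cons j m ih => simp [ih, starLeft_foldl]

lemma star_foldl (x : Equiv.Perm (Fin n)) (l : List (Fin (n - 1))) :
    star x (l.foldl (fun x i => starRight i x) 1) = l.foldl (fun x i => starRight i x) x := by
  rw [star, foldr_foldl, foldr_reducedWord]

lemma star_eq_foldr {x : Equiv.Perm (Fin n)} {m : List (Fin (n - 1))}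
    (h : m.foldr starLeft 1 = x) (y : Equiv.Perm (Fin n)) : star x y = m.foldr starLeft y := by
  obtain ⟨l, rfl⟩ := exists_foldl y
  rw [star_foldl, foldr_foldl, h]

lemma star_one (x : Equiv.Perm (Fin n)) : star x 1 = x := foldr_reducedWord x

lemma one_star (x : Equiv.Perm (Fin n)) : star 1 x = x := star_eq_foldr (m := []) rfl x

lemma starLeft_star (i : Fin (n - 1)) (x y : Equiv.Perm (Fin n)) :
    star (starLeft i x) y = starLeft i (star x y) :=
  star_eq_foldr (m := i :: reducedWord x) (by simp [foldr_reducedWord]) y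

lemma star_starRight (i : Fin (n - 1)) (x y : Equiv.Perm (Fin n)) :
    star x (starRight i y) = starRight i (star x y) := by
  obtain ⟨l, rfl⟩ := exists_foldl y
  have := star_foldl x (l ++ [i])
  simp only [List.foldl_append, List.foldl_cons, List.foldl_nil] at this
  rw [this, star_foldl]

lemma star_assoc (x y z : Equiv.Perm (Fin n)) : star (star x y) z = star x (star y z) := by
  rw [star_eq_foldr (m := reducedWord x ++ reducedWord y) (x := star x y)
    (by rw [List.foldr_append, foldr_reducedWord]; rfl) z, List.foldr_append]
  rfl

lemma simple_star (i : Fin (n - 1)) (y : Equiv.Perm (Fin n)) :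
    star (starLeft i 1) y = starLeft i y := by rw [starLeft_star, one_star]

lemma starLeft_one (i : Fin (n - 1)) : starLeft i 1 = starRight i (1 : Equiv.Perm (Fin n)) := by
  simp [starLeft, starRight]

lemma star_simple (i : Fin (n - 1)) (y : Equiv.Perm (Fin n)) :
    star y (starLeft i 1) = starRight i y := by rw [starLeft_one, star_starRight, star_one]

lemma len_reducedWord (x : Equiv.Perm (Fin n)) : (reducedWord x).length = len x :=
  (exists_reduced_word x).choose_spec.2

lemma prod_reducedWord (x : Equiv.Perm (Fin n)) : ((reducedWord x).map simple).prod = x :=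
  (exists_reduced_word x).choose_spec.1

lemma len_star_le (x y : Equiv.Perm (Fin n)) : len (star x y) ≤ len x + len y := by
  have := foldr_le (reducedWord x) y
  rwa [len_reducedWord] at this

lemma star_eq_mul_of_len {x y : Equiv.Perm (Fin n)} (h : len (star x y) = len x + len y) :
    star x y = x * y := by
  have := foldr_eq_of_len (reducedWord x) y (by rwa [len_reducedWord])
  rwa [prod_reducedWord] at this

lemma star_eq_mul_of_len' {x y : Equiv.Perm (Fin n)} (h : len (x * y) = len x + len y) :
    star x y = x * y := by
  have := foldr_eq_of_len' (reducedWord x) y (by rwa [prod_reducedWord, len_reducedWord])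
  rwa [prod_reducedWord] at this

/-! ### Parabolic subgroups and double cosets -/

/-- The parabolic subgroup `W_J`. -/
def parabolic (J : Finset (Fin (n - 1))) : Subgroup (Equiv.Perm (Fin n)) :=
  Subgroup.closure (simple '' (J : Set (Fin (n - 1))))

lemma exists_longest (J : Finset (Fin (n - 1))) :
    ∃ w ∈ parabolic J, ∀ v ∈ parabolic J, len v ≤ len w := by
  classical
  obtain ⟨w, hw, h⟩ := Finset.exists_max_image
    (Finset.univ.filter fun w : Equiv.Perm (Fin n) => w ∈ parabolic J) len
    ⟨1, by simp⟩
  simp only [Finset.mem_filter, Finset.mem_univ, true_and] at hw h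
  exact ⟨w, hw, h⟩

/-- The longest element `w_J` of `W_J`. -/
def longest (J : Finset (Fin (n - 1))) : Equiv.Perm (Fin n) := (exists_longest J).choose

/-- `(I, J)`-cosets, i.e. elements of `W_I \ S_n / W_J`. -/
abbrev Coset (I J : Finset (Fin (n - 1))) : Type :=
  DoubleCoset.Quotient (parabolic I : Set (Equiv.Perm (Fin n))) (parabolic J)

/-- The `(I, J)`-coset containing `w`. -/
def Coset.mk (I J : Finset (Fin (n - 1))) (w : Equiv.Perm (Fin n)) : Coset I J :=
  DoubleCoset.mk (parabolic I) (parabolic J) w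

variable {I J K L : Finset (Fin (n - 1))}

lemma Coset.exists_max (p : Coset I J) :
    ∃ w, Coset.mk I J w = p ∧ ∀ v, Coset.mk I J v = p → len v ≤ len w := by
  classical
  obtain ⟨w, hw, h⟩ := Finset.exists_max_image
    (Finset.univ.filter fun w : Equiv.Perm (Fin n) => Coset.mk I J w = p) len
    (by
      obtain ⟨w, rfl⟩ := Quotient.exists_rep p
      exact ⟨w, by simp; rfl⟩)
  simp only [Finset.mem_filter, Finset.mem_univ, true_and] at hw h
  exact ⟨w, hw, h⟩

/-- The maximal element of a double coset, i.e. its unique longest element. -/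
def Coset.max (p : Coset I J) : Equiv.Perm (Fin n) := p.exists_max.choose

/-- The composition `p * q` of double cosets in the singular Coxeter monoid. -/
def Coset.star (p : Coset I J) (q : Coset J K) : Coset I K :=
  Coset.mk I K (TypeA.star p.max q.max)

/-- `x . y = z`, i.e. `z = x y` with lengths adding up. -/
def ReducedProd (x y z : Equiv.Perm (Fin n)) : Prop :=
  z = x * y ∧ len z = len x + len y

/-- The composition `p * q` is reduced. -/
def Coset.IsReduced (p : Coset I J) (q : Coset J K) : Prop :=
  ReducedProd (p.max * (longest J)⁻¹) q.max (TypeA.star p.max q.max) ∧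
    ReducedProd p.max ((longest J)⁻¹ * q.max) (TypeA.star p.max q.max)

lemma longest_mem (J : Finset (Fin (n - 1))) : longest J ∈ parabolic J :=
  (exists_longest J).choose_spec.1

lemma len_le_longest {v : Equiv.Perm (Fin n)} (hv : v ∈ parabolic J) : len v ≤ len (longest J) :=
  (exists_longest J).choose_spec.2 v hv

lemma simple_mem {i : Fin (n - 1)} (h : i ∈ J) : simple i ∈ parabolic J :=
  Subgroup.subset_closure ⟨i, h, rfl⟩

lemma Coset.mk_max (p : Coset I J) : Coset.mk I J p.max = p := p.exists_max.choose_spec.1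

lemma Coset.len_le_max {p : Coset I J} {v : Equiv.Perm (Fin n)} (h : Coset.mk I J v = p) :
    len v ≤ len p.max := p.exists_max.choose_spec.2 v h

lemma Coset.mk_eq_iff {x y : Equiv.Perm (Fin n)} :
    Coset.mk I J x = Coset.mk I J y ↔ ∃ h ∈ parabolic I, ∃ k ∈ parabolic J, y = h * x * k :=
  DoubleCoset.eq _ _ _ _

/-- Left absorption of the generators in `I`. -/
def AbsL (I : Finset (Fin (n - 1))) (x : Equiv.Perm (Fin n)) : Prop := ∀ i ∈ I, starLeft i x = x

/-- Right absorption of the generators in `I`. -/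
def AbsR (I : Finset (Fin (n - 1))) (x : Equiv.Perm (Fin n)) : Prop := ∀ i ∈ I, starRight i x = x

lemma absL_longest (J : Finset (Fin (n - 1))) : AbsL J (longest J) := fun _ hi =>
  if_neg (not_lt.2 (len_le_longest (Subgroup.mul_mem _ (simple_mem hi) (longest_mem J))))

lemma absR_longest (J : Finset (Fin (n - 1))) : AbsR J (longest J) := fun _ hi =>
  if_neg (not_lt.2 (len_le_longest (Subgroup.mul_mem _ (longest_mem J) (simple_mem hi))))

lemma absL_max (p : Coset I J) : AbsL I p.max := fun i hi =>
  if_neg (not_lt.2 (Coset.len_le_max (by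
    conv_rhs => rw [← p.mk_max]
    rw [eq_comm, Coset.mk_eq_iff]
    exact ⟨simple i, simple_mem hi, 1, Subgroup.one_mem _, by simp⟩)))

lemma absR_max (p : Coset I J) : AbsR J p.max := fun i hi =>
  if_neg (not_lt.2 (Coset.len_le_max (by
    conv_rhs => rw [← p.mk_max]
    rw [eq_comm, Coset.mk_eq_iff]
    exact ⟨1, Subgroup.one_mem _, simple i, simple_mem hi, by simp⟩)))

lemma parabolic_le {v : Equiv.Perm (Fin n)} (hv : v ∈ parabolic J) {k : Fin (n - 1)}
    (hk : k ∉ J) (a : Fin n) : v a ≤ lo k ↔ a ≤ lo k := by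
  induction hv using Subgroup.closure_induction generalizing a with
  | mem x hx =>
    obtain ⟨i, hi', rfl⟩ := hx
    have hne : i ≠ k := fun e => hk (e ▸ hi')
    have hne : (i : ℕ) ≠ k := fun e => hne (Fin.ext e)
    simp only [simple, Equiv.swap_apply_def]
    split_ifs <;> simp only [lo, hi, Fin.ext_iff, Fin.le_def] at * <;> omega
  | one => simp
  | mul x y _ _ hx hy => rw [Equiv.Perm.mul_apply, hx, hy]
  | inv x _ hx => rw [← hx, ← Equiv.Perm.mul_apply, mul_inv_cancel, Equiv.Perm.one_apply]

/-- A nontrivial element of `W_J` has a right descent in `J`. -/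
lemma exists_descR_parabolic {v : Equiv.Perm (Fin n)} (hv : v ∈ parabolic J) (hne : v ≠ 1) :
    ∃ i ∈ J, v (hi i) < v (lo i) := by
  obtain ⟨i, h⟩ := exists_descR hne
  refine ⟨i, ?_, h⟩
  by_contra hi'
  have h1 := (parabolic_le hv hi' (lo i)).2 le_rfl
  have h2 := (parabolic_le hv hi' (hi i)).1 (h.le.trans h1)
  exact absurd (lo_lt_hi i) (not_lt.2 h2)

lemma parabolic_induction {P : Equiv.Perm (Fin n) → Prop} (one : P 1)
    (mul : ∀ (u : Equiv.Perm (Fin n)) (i : Fin (n - 1)), u ∈ parabolic J → i ∈ J →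
      u (lo i) < u (hi i) → P u → P (u * simple i))
    {v : Equiv.Perm (Fin n)} (hv : v ∈ parabolic J) : P v := by
  induction hk : len v using Nat.strong_induction_on generalizing v with
  | _ k ih =>
    by_cases hne : v = 1
    · rwa [hne]
    · obtain ⟨i, hiJ, h⟩ := exists_descR_parabolic hv hne
      have hu : v * simple i ∈ parabolic J := Subgroup.mul_mem _ hv (simple_mem hiJ)
      have hl := len_descR (i := i) (w := v) (by rw [ascR_iff]; exact not_lt.2 h.le)
      have := mul (v * simple i) i hu hiJ
        (by rwa [Equiv.Perm.mul_apply, Equiv.Perm.mul_apply, simple_lo, simple_hi])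
        (ih _ (by omega) hu rfl)
      rwa [mul_simple_mul_simple] at this

lemma star_absR {x v : Equiv.Perm (Fin n)} (hx : AbsR J x) (hv : v ∈ parabolic J) :
    star x v = x := by
  refine parabolic_induction (P := fun v => star x v = x) (star_one x) ?_ hv
  · intro u i _ hi' h ih
    have e : u * simple i = starRight i u := (if_pos (ascR_iff.2 h)).symm
    rw [e, star_starRight, ih, hx i hi']

lemma starRight_inv (i : Fin (n - 1)) (w : Equiv.Perm (Fin n)) :
    (starRight i w)⁻¹ = starLeft i w⁻¹ := by
  rw [inv_eq_iff_eq_inv, starLeft_inv, inv_inv]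

lemma star_inv (x y : Equiv.Perm (Fin n)) : (star x y)⁻¹ = star y⁻¹ x⁻¹ := by
  have h := foldl_starRight (reducedWord x) y
  have h' := foldl_starRight (reducedWord x) 1
  rw [foldr_reducedWord, inv_one] at h'
  rw [star, ← h, ← h', star_foldl]

lemma absL_inv {x : Equiv.Perm (Fin n)} (hx : AbsL J x) : AbsR J x⁻¹ := fun i hi' => by
  rw [← starLeft_inv, hx i hi']

lemma absR_inv {x : Equiv.Perm (Fin n)} (hx : AbsR J x) : AbsL J x⁻¹ := fun i hi' => by
  rw [← starRight_inv, hx i hi']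

lemma star_absL {x v : Equiv.Perm (Fin n)} (hx : AbsL J x) (hv : v ∈ parabolic J) :
    star v x = x := by
  have := star_absR (absL_inv hx) (Subgroup.inv_mem _ hv)
  rwa [← star_inv, inv_inj] at this

lemma longest_inv (J : Finset (Fin (n - 1))) : (longest J)⁻¹ = longest J := by
  have h1 := star_absR (absR_longest J) (Subgroup.inv_mem _ (longest_mem J))
  have h2 := star_absL (absR_inv (absR_longest J)) (longest_mem J)
  rw [← h2, h1]

lemma starLeft_simple_mul (i : Fin (n - 1)) (z : Equiv.Perm (Fin n)) :
    starLeft i (simple i * z) = starLeft i z := by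
  unfold starLeft
  rw [simple_mul_simple_mul]
  by_cases h : len z < len (simple i * z)
  · rw [if_pos h, if_neg (by omega)]
  · have := len_descL h
    rw [if_neg h, if_pos (by omega)]

lemma longest_star_mul {u : Equiv.Perm (Fin n)} (hu : u ∈ parabolic I) (z : Equiv.Perm (Fin n)) :
    star (longest I) (u * z) = star (longest I) z := by
  refine parabolic_induction
    (P := fun u => ∀ z, star (longest I) (u * z) = star (longest I) z) ?_ ?_ hu z
  · intro z
    rw [one_mul]
  · intro u i _ hi' _ ih z
    have key : ∀ y, star (longest I) y = star (longest I) (starLeft i y) := fun y => by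
      conv_lhs => rw [← absR_longest I i hi', ← star_simple, star_assoc, simple_star]
    rw [mul_assoc, ih, key, starLeft_simple_mul, ← key]

lemma mul_star_longest {u : Equiv.Perm (Fin n)} (hu : u ∈ parabolic J) (z : Equiv.Perm (Fin n)) :
    star (z * u) (longest J) = star z (longest J) := by
  have := longest_star_mul (Subgroup.inv_mem _ hu) z⁻¹
  rw [← mul_inv_rev, ← longest_inv, ← star_inv, ← star_inv, inv_inj] at this
  exact this

lemma Coset.max_mk (z : Equiv.Perm (Fin n)) :
    (Coset.mk I J z).max = TypeA.star (TypeA.star (longest I) z) (longest J) := by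
  set p := Coset.mk I J z with hp
  have h := p.mk_max
  rw [hp, eq_comm, Coset.mk_eq_iff] at h
  obtain ⟨a, ha, b, hb, e⟩ := h
  have h1 : TypeA.star (TypeA.star (longest I) p.max) (longest J) = p.max := by
    rw [star_absL (absL_max p) (longest_mem I), star_absR (absR_max p) (longest_mem J)]
  rw [← h1, ← hp] at *
  rw [e, mul_assoc, longest_star_mul ha, star_assoc, mul_star_longest hb, ← star_assoc]

lemma Coset.max_mk_of_abs {x : Equiv.Perm (Fin n)} (hL : AbsL I x) (hR : AbsR J x) :
    (Coset.mk I J x).max = x := by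
  rw [Coset.max_mk, star_absL hL (longest_mem I), star_absR hR (longest_mem J)]

lemma Coset.max_star (p : Coset I J) (q : Coset J K) :
    (p.star q).max = TypeA.star p.max q.max :=
  Coset.max_mk_of_abs (fun i hi' => by rw [← starLeft_star, absL_max p i hi'])
    (fun i hi' => by rw [← star_starRight, absR_max q i hi'])

lemma Coset.ext_max {p q : Coset I J} (h : p.max = q.max) : p = q := by
  rw [← p.mk_max, ← q.mk_max, h]

lemma len_mul_parabolic {y u : Equiv.Perm (Fin n)} (hy : ∀ j ∈ J, y (lo j) < y (hi j))
    (hu : u ∈ parabolic J) : len (y * u) = len y + len u := by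
  have block : ∀ (k : ℕ) (a b : Fin n), (b : ℕ) = a + k + 1 →
      (∀ i : Fin (n - 1), (a : ℕ) ≤ i → (i : ℕ) < b → i ∈ J) → y a < y b := by
    intro k
    induction k with
    | zero =>
      intro a b hab h
      have hb := b.2
      have h1 := hy ⟨a, by omega⟩ (h ⟨a, by omega⟩ (by simp) (by simp; omega))
      have e : hi (⟨a, by omega⟩ : Fin (n - 1)) = b := by
        apply Fin.ext; simp [hi]; omega
      rw [e] at h1
      exact h1
    | succ k ih =>
      intro a b hab h
      have hb := b.2
      have h1 := hy ⟨a + k + 1, by omega⟩ (h ⟨a + k + 1, by omega⟩ (by simp; omega)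
        (by simp; omega))
      have e : hi (⟨a + k + 1, by omega⟩ : Fin (n - 1)) = b := by
        apply Fin.ext; simp [hi]; omega
      rw [e] at h1
      refine (ih a _ rfl fun i h2 h3 => h i h2 ?_).trans h1
      simp [lo] at h3
      omega
  refine parabolic_induction (P := fun u => len (y * u) = len y + len u) ?_ ?_ hu
  · rw [mul_one, len_one, add_zero]
  · intro u i hu hiJ h ih
    rw [len_mul_simple h, ← mul_assoc, len_mul_simple, ih, add_assoc]
    rw [Equiv.Perm.mul_apply, Equiv.Perm.mul_apply]
    refine block (u (hi i) - u (lo i) - 1) _ _ (by have := Fin.lt_def.1 h; omega) ?_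
    intro k h1 h2
    by_contra hk
    have hik : i ≠ k := fun e => hk (e ▸ hiJ)
    have hik : (i : ℕ) ≠ k := fun e => hik (Fin.ext e)
    have h3 := (parabolic_le hu hk (lo i)).1 h1
    have h4 : ¬ hi i ≤ lo k := fun h5 => by
      have := (parabolic_le hu hk (hi i)).2 h5
      simp only [lo, Fin.le_def] at this
      omega
    simp only [lo, hi, Fin.le_def] at h3 h4
    omega

lemma len_mul_longest_inv {x : Equiv.Perm (Fin n)} (hx : AbsR J x) :
    len (x * (longest J)⁻¹) + len (longest J) = len x := by
  classical
  obtain ⟨v, hv, hmin⟩ := Finset.exists_min_image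
    (Finset.univ.filter fun w : Equiv.Perm (Fin n) => w ∈ parabolic J) (fun v => len (x * v))
    ⟨1, by simp⟩
  simp only [Finset.mem_filter, Finset.mem_univ, true_and] at hv hmin
  have hy : ∀ j ∈ J, (x * v) (lo j) < (x * v) (hi j) := by
    intro j hj
    rw [← ascR_iff]
    by_contra h
    have h1 := len_descR h
    have h2 := hmin (v * simple j) (Subgroup.mul_mem _ hv (simple_mem hj))
    rw [← mul_assoc] at h2
    omega
  have h1 : star (x * v) v⁻¹ = x := by
    rw [star_eq_mul_of_len' (len_mul_parabolic hy (Subgroup.inv_mem _ hv)), mul_inv_cancel_right]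
  have h2 : star x (longest J) = x := star_absR hx (longest_mem J)
  rw [← h1, star_assoc, star_absL (absL_longest J) (Subgroup.inv_mem _ hv), h1,
    star_eq_mul_of_len' (len_mul_parabolic hy (longest_mem J))] at h2
  have h3 := len_mul_parabolic hy (longest_mem J)
  rw [h2] at h3
  rw [← h2, mul_inv_cancel_right, h2]
  omega

lemma len_longest_inv_mul {x : Equiv.Perm (Fin n)} (hx : AbsL J x) :
    len ((longest J)⁻¹ * x) + len (longest J) = len x := by
  have := len_mul_longest_inv (absL_inv hx)
  rwa [len_inv x, ← len_inv (x⁻¹ * _), mul_inv_rev, inv_inv, inv_inv, ← longest_inv,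
    len_inv (longest J)] at this

lemma star_longest_inv {x y : Equiv.Perm (Fin n)} (hx : AbsR J x) (hy : AbsL J y) :
    star (x * (longest J)⁻¹) y = star x y := by
  have h1 : star (x * (longest J)⁻¹) (longest J) = x := by
    rw [star_eq_mul_of_len' (by rw [inv_mul_cancel_right, len_mul_longest_inv hx]),
      inv_mul_cancel_right]
  conv_rhs => rw [← h1, star_assoc, star_absL hy (longest_mem J)]

lemma len_star_add_le {x y : Equiv.Perm (Fin n)} (hx : AbsR J x) (hy : AbsL J y) :
    len (star x y) + len (longest J) ≤ len x + len y := by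
  rw [← star_longest_inv hx hy]
  have h1 := len_star_le (x * (longest J)⁻¹) y
  have h2 := len_mul_longest_inv hx
  omega

lemma Coset.isReduced_iff {p : Coset I J} {q : Coset J K} :
    p.IsReduced q ↔ len (TypeA.star p.max q.max) + len (longest J) = len p.max + len q.max := by
  have h1 := len_mul_longest_inv (absR_max p)
  have h2 := len_longest_inv_mul (absL_max q)
  constructor
  · rintro ⟨⟨-, h⟩, -⟩
    omega
  · intro h
    have h3 : TypeA.star p.max q.max = p.max * (longest J)⁻¹ * q.max := by
      rw [← star_longest_inv (absR_max p) (absL_max q)]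
      apply star_eq_mul_of_len
      rw [star_longest_inv (absR_max p) (absL_max q)]
      omega
    exact ⟨⟨h3, by omega⟩, ⟨by rw [h3, mul_assoc], by omega⟩⟩

lemma Coset.star_assoc (p : Coset I J) (q : Coset J K) (r : Coset K L) :
    (p.star q).star r = p.star (q.star r) :=
  Coset.ext_max (by simp only [Coset.max_star, TypeA.star_assoc])

lemma Coset.isReduced_assoc (p : Coset I J) (q : Coset J K) (r : Coset K L) :
    (p.IsReduced q ∧ (p.star q).IsReduced r) ↔ (q.IsReduced r ∧ p.IsReduced (q.star r)) := by
  simp only [Coset.isReduced_iff, Coset.max_star, TypeA.star_assoc]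
  have h1 := len_star_add_le (absR_max p) (absL_max q)
  have h2 := len_star_add_le (absR_max q) (absL_max r)
  have h3 := len_star_add_le (absR_max (p.star q)) (absL_max r)
  have h4 := len_star_add_le (absR_max p) (absL_max (q.star r))
  simp only [Coset.max_star, TypeA.star_assoc] at h3 h4
  omega

lemma Coset.max_one (I : Finset (Fin (n - 1))) : (Coset.mk I I 1).max = longest I := by
  rw [Coset.max_mk, TypeA.star_one, star_absR (absR_longest I) (longest_mem I)]

lemma Coset.one_star (p : Coset I J) :
    (Coset.mk I I 1).IsReduced p ∧ (Coset.mk I I 1).star p = p := by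
  have h : TypeA.star (longest I) p.max = p.max := star_absL (absL_max p) (longest_mem I)
  refine ⟨?_, Coset.ext_max ?_⟩
  · rw [Coset.isReduced_iff, Coset.max_one, h, add_comm]
  · rw [Coset.max_star, Coset.max_one, h]

lemma Coset.star_one (p : Coset I J) :
    p.IsReduced (Coset.mk J J 1) ∧ p.star (Coset.mk J J 1) = p := by
  have h : TypeA.star p.max (longest J) = p.max := star_absR (absR_max p) (longest_mem J)
  refine ⟨?_, Coset.ext_max ?_⟩
  · rw [Coset.isReduced_iff, Coset.max_one, h]
  · rw [Coset.max_star, Coset.max_one, h]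

/-! ### The nilCoxeter algebroid `D` and its atomic subcategory -/

/-- Objects of the nilCoxeter algebroid `D(S_n)` over `R`: subsets of the set of simple
reflections. -/
structure NilCoxeter (R : Type u) (n : ℕ) where
  subset : Finset (Fin (n - 1))

open Classical in
/-- The composition `∂_p ∘ ∂_q`, namely `∂_{p * q}` if `p * q` is reduced and `0` otherwise. -/
def demazureComp (R : Type u) [CommRing R] (p : Coset I J) (q : Coset J K) : Coset I K →₀ R :=
  if p.IsReduced q then Finsupp.single (p.star q) 1 else 0

/-- The bilinear extension of `demazureComp`. -/
def nilComp (R : Type u) [CommRing R] (I J K : Finset (Fin (n - 1))) :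
    (Coset I J →₀ R) →ₗ[R] (Coset J K →₀ R) →ₗ[R] (Coset I K →₀ R) :=
  Finsupp.linearCombination R fun p => Finsupp.linearCombination R fun q => demazureComp R p q

variable {R : Type u} [CommRing R]

lemma nilComp_single (p : Coset I J) (q : Coset J K) :
    nilComp R I J K (Finsupp.single p 1) (Finsupp.single q 1) = demazureComp R p q := by
  simp [nilComp]

lemma nilComp_assoc_single (p : Coset I J) (q : Coset J K) (r : Coset K L) :
    nilComp R I K L (demazureComp R p q) (Finsupp.single r 1) =
      nilComp R I J L (Finsupp.single p 1) (demazureComp R q r) := by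
  have h := Coset.isReduced_assoc p q r
  by_cases h1 : p.IsReduced q
  · by_cases h2 : (p.star q).IsReduced r
    · obtain ⟨h3, h4⟩ := h.1 ⟨h1, h2⟩
      rw [demazureComp, demazureComp, if_pos h1, if_pos h3, nilComp_single, nilComp_single,
        demazureComp, demazureComp, if_pos h2, if_pos h4, Coset.star_assoc]
    · rw [demazureComp, if_pos h1, nilComp_single, demazureComp, if_neg h2]
      by_cases h3 : q.IsReduced r
      · have h4 : ¬ p.IsReduced (q.star r) := fun h4 => h2 (h.2 ⟨h3, h4⟩).2
        rw [demazureComp, if_pos h3, nilComp_single, demazureComp, if_neg h4]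
      · rw [demazureComp, if_neg h3, map_zero]
  · rw [demazureComp, if_neg h1, map_zero, LinearMap.zero_apply]
    by_cases h3 : q.IsReduced r
    · have h4 : ¬ p.IsReduced (q.star r) := fun h4 => h1 (h.2 ⟨h3, h4⟩).1
      rw [demazureComp, if_pos h3, nilComp_single, demazureComp, if_neg h4]
    · rw [demazureComp, if_neg h3, map_zero]

lemma nilComp_assoc (f : Coset I J →₀ R) (g : Coset J K →₀ R) (h : Coset K L →₀ R) :
    nilComp R I K L (nilComp R I J K f g) h = nilComp R I J L f (nilComp R J K L g h) := by
  induction f using Finsupp.induction_linear with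
  | zero => simp
  | add f₁ f₂ h₁ h₂ => simp only [map_add, LinearMap.add_apply, h₁, h₂]
  | single p r =>
    induction g using Finsupp.induction_linear with
    | zero => simp
    | add f₁ f₂ h₁ h₂ => simp only [map_add, LinearMap.add_apply, h₁, h₂]
    | single q s =>
      induction h using Finsupp.induction_linear with
      | zero => simp
      | add f₁ f₂ h₁ h₂ => simp only [map_add, h₁, h₂]
      | single t a =>
        rw [← mul_one r, ← mul_one s, ← mul_one a, ← smul_eq_mul, ← smul_eq_mul, ← smul_eq_mul,
          ← Finsupp.smul_single, ← Finsupp.smul_single, ← Finsupp.smul_single]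
        simp only [map_smul, LinearMap.smul_apply, nilComp_single, nilComp_assoc_single]

lemma nilComp_id_left (f : Coset I J →₀ R) :
    nilComp R I I J (Finsupp.single (Coset.mk I I 1) 1) f = f := by
  induction f using Finsupp.induction_linear with
  | zero => simp
  | add f₁ f₂ h₁ h₂ => simp only [map_add, h₁, h₂]
  | single p r =>
    obtain ⟨h1, h2⟩ := Coset.one_star p
    rw [← mul_one r, ← smul_eq_mul, ← Finsupp.smul_single, map_smul, nilComp_single,
      demazureComp, if_pos h1, h2]

lemma nilComp_id_right (f : Coset I J →₀ R) :
    nilComp R I J J f (Finsupp.single (Coset.mk J J 1) 1) = f := by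
  induction f using Finsupp.induction_linear with
  | zero => simp
  | add f₁ f₂ h₁ h₂ => simp only [map_add, LinearMap.add_apply, h₁, h₂]
  | single p r =>
    obtain ⟨h1, h2⟩ := Coset.star_one p
    rw [← mul_one r, ← smul_eq_mul, ← Finsupp.smul_single, map_smul, LinearMap.smul_apply,
      nilComp_single, demazureComp, if_pos h1, h2]

namespace NilCoxeter

/-- Morphisms from `J` to `I`: the free module on the `(I, J)`-cosets. Here `f ≫ g` is the
composition written `g ∘ f`. -/
instance : Category.{u} (NilCoxeter R n) where
  Hom Y X := Coset X.subset Y.subset →₀ R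
  id X := Finsupp.single (Coset.mk X.subset X.subset 1) 1
  comp {X Y Z} f g := nilComp R Z.subset Y.subset X.subset g f
  id_comp f := nilComp_id_right f
  comp_id f := nilComp_id_left f
  assoc f g h := (nilComp_assoc h g f).symm

instance : Preadditive (NilCoxeter R n) where
  homGroup Y X := inferInstanceAs (AddCommGroup (Coset X.subset Y.subset →₀ R))
  add_comp X Y Z f f' g := (nilComp R Z.subset Y.subset X.subset g).map_add f f'
  comp_add X Y Z f g g' := LinearMap.map_add₂ (nilComp R Z.subset Y.subset X.subset) g g' f

instance : Linear R (NilCoxeter R n) where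
  homModule Y X := inferInstanceAs (Module R (Coset X.subset Y.subset →₀ R))
  smul_comp X Y Z r f g := (nilComp R Z.subset Y.subset X.subset g).map_smul r f
  comp_smul X Y Z f r g := LinearMap.map_smul₂ (nilComp R Z.subset Y.subset X.subset) r g f

/-- The basis morphism `∂_p` from `J` to `I` of an `(I, J)`-coset `p`. -/
def del (R : Type u) [CommRing R] (p : Coset I J) :
    (⟨J⟩ : NilCoxeter R n) ⟶ (⟨I⟩ : NilCoxeter R n) :=
  (Finsupp.single p 1 : Coset I J →₀ R)

end NilCoxeter

/-- An `(I, J)`-coset is atomic if there are `M`, `s ∈ M` and `t = w_M s w_M` with `I = M \ s` and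
`J = M \ t`, and the coset contains `w_M`. -/
def Coset.IsAtomic (p : Coset I J) : Prop :=
  ∃ (M : Finset (Fin (n - 1))) (s t : Fin (n - 1)), s ∈ M ∧ t ∈ M ∧
    simple t = longest M * simple s * longest M ∧ I = M.erase s ∧ J = M.erase t ∧
    p = Coset.mk I J (longest M)

/-- The morphisms `∂_p` for `p` atomic. -/
def atomicMorphisms (R : Type u) [CommRing R] (n : ℕ) : MorphismProperty (NilCoxeter R n) :=
  fun Y X f => ∃ p : Coset X.subset Y.subset, p.IsAtomic ∧ f = NilCoxeter.del R p

/-- The category `AD(S_n)`, generated inside `D(S_n)` by the `∂_p` with `p` atomic. -/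
abbrev AD (R : Type u) [CommRing R] (n : ℕ) : Type :=
  GeneratedSubcategory R (atomicMorphisms R n)

/-- The simple reflection `d_i`, where `d_1 < ⋯ < d_ℓ` are the elements of the complement of `J`
(here numbered from `0`). -/
def outer (J : Finset (Fin (n - 1))) (i : Fin Jᶜ.card) : Fin (n - 1) := Jᶜ.orderEmbOfFin rfl i

/-- The set `J s` with `s = d_i`. -/
def atomicTop (J : Finset (Fin (n - 1))) (i : Fin Jᶜ.card) : Finset (Fin (n - 1)) :=
  insert (outer J i) J

/-- The set `J s \ t` with `s = d_i` and `t = w_{Js} s w_{Js}`. -/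
def atomicTarget (J : Finset (Fin (n - 1))) (i : Fin Jᶜ.card) : Finset (Fin (n - 1)) :=
  (atomicTop J i).filter fun t =>
    simple t ≠ longest (atomicTop J i) * simple (outer J i) * longest (atomicTop J i)

/-- The atomic coset `a_i^J`: the `(J s \ t, J)`-coset containing `w_{Js}`. -/
def atomicCoset (J : Finset (Fin (n - 1))) (i : Fin Jᶜ.card) : Coset (atomicTarget J i) J :=
  Coset.mk _ _ (longest (atomicTop J i))

/-! ### The labeled nilCoxeter algebroid -/

/-- Sequences of strand labels, i.e. compositions of `n`. -/
structure Strands (n : ℕ) where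
  labels : Composition n

/-- `IsCrossing i c d`: the sequence `d` is obtained from `c` by exchanging the labels in the
adjacent positions `i` and `i + 1` (positions are numbered from `0`). -/
def IsCrossing (i : ℕ) (c d : Composition n) : Prop :=
  ∃ (l r : List ℕ) (a b : ℕ), l.length = i ∧ c.blocks = l ++ a :: b :: r ∧
    d.blocks = l ++ b :: a :: r

/-- The generating crossings. -/
instance : Quiver.{0} (Strands n) where
  Hom c d := {i : ℕ // IsCrossing i c.labels d.labels}

/-- The crossing of the strands in positions `i` and `i + 1`, as a path of length one. -/
def crossing {c d : Strands n} (i : ℕ) (h : IsCrossing i c.labels d.labels) : Quiver.Path c d :=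
  Quiver.Hom.toPath (⟨i, h⟩ : c ⟶ d)

/-- The braid relations, the commutation relations and the nil relations on crossings. -/
inductive NilRelator (R : Type u) [CommRing R] (n : ℕ) :
    ∀ c d : Strands n, (Quiver.Path c d →₀ R) → Prop
  | braid (i : ℕ) {c c₁ c₂ d₁ d₂ d : Strands n}
      (h₁ : IsCrossing i c.labels c₁.labels) (h₂ : IsCrossing (i + 1) c₁.labels c₂.labels)
      (h₃ : IsCrossing i c₂.labels d.labels)
      (k₁ : IsCrossing (i + 1) c.labels d₁.labels) (k₂ : IsCrossing i d₁.labels d₂.labels)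
      (k₃ : IsCrossing (i + 1) d₂.labels d.labels) :
      NilRelator R n c d
        (Finsupp.single (((crossing i h₁).comp (crossing (i + 1) h₂)).comp (crossing i h₃)) 1 -
          Finsupp.single
            (((crossing (i + 1) k₁).comp (crossing i k₂)).comp (crossing (i + 1) k₃)) 1)
  | comm (i j : ℕ) (hij : i + 1 < j ∨ j + 1 < i) {c c₁ d₁ d : Strands n}
      (h₁ : IsCrossing j c.labels c₁.labels) (h₂ : IsCrossing i c₁.labels d.labels)
      (k₁ : IsCrossing i c.labels d₁.labels) (k₂ : IsCrossing j d₁.labels d.labels) :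
      NilRelator R n c d
        (Finsupp.single ((crossing j h₁).comp (crossing i h₂)) 1 -
          Finsupp.single ((crossing i k₁).comp (crossing j k₂)) 1)
  | nil (i : ℕ) {c c₁ d : Strands n}
      (h₁ : IsCrossing i c.labels c₁.labels) (h₂ : IsCrossing i c₁.labels d.labels) :
      NilRelator R n c d (Finsupp.single ((crossing i h₁).comp (crossing i h₂)) 1)

/-- The labeled nilCoxeter algebroid `NC(n)`. -/
abbrev NC (R : Type u) [CommRing R] (n : ℕ) : Type :=
  Presented R (Strands n) fun c d => {x | NilRelator R n c d x}

/-- The composition `c`, regarded as an object of `NC(n)`. -/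
def NC.of (R : Type u) [CommRing R] (c : Composition n) : NC R n := ⟨⟨c⟩⟩

/-- The generating morphism `∂_i` with source `c`. -/
def NC.del (R : Type u) [CommRing R] {c d : Composition n} (i : ℕ) (h : IsCrossing i c d) :
    NC.of R c ⟶ NC.of R d :=
  Presented.gen (⟨i, h⟩ : (NC.of R c).vertex ⟶ (NC.of R d).vertex)

/-- The set of simple reflections exchanging two letters in the same block of a composition. -/
def subsetOf (c : Composition n) : Finset (Fin (n - 1)) :=
  Finset.univ.filter fun j => c.index (lo j) = c.index (hi j)

end

end TypeA

/-!
Call a permutation carrying the adjacent pairs exchanged by `J` increasingly onto those exchanged by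
`I` a block permutation. If `x` is one, its `(I, J)`-coset determines it, and the longest element of
the coset is `x * longest J`. Hence the product of the cosets of two block permutations is reduced
exactly if the lengths of the permutations add up, and it is then the coset of their product. The
atomic cosets are the cosets of the permutations exchanging two adjacent blocks, so a path of
crossings is sent to the `∂` of the coset of its permutation if the path is reduced, and to `0`
otherwise; since the relations of `NC(n)` respect this, the functor exists, and it is full onto the
subcategory generated by the atomic cosets. It is faithful by a word property in the style of
Matsumoto: reduced paths performing the same permutation agree modulo the braid and commutation
relations, and a path that is not reduced vanishes by the relation `∂ᵢ∂ᵢ = 0`.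
-/

/-! ### Linear functors out of presented categories -/

namespace Presented

noncomputable section

variable {R : Type u} [CommRing R] {V : Type} [Quiver.{0} V]
  {rel : ∀ a b : V, Set (Quiver.Path a b →₀ R)}

/-- The morphism of the presented category represented by a path of generators. -/
def ofPath {X Y : Presented R V rel} (p : Quiver.Path X.vertex Y.vertex) : X ⟶ Y :=
  toHom X Y (Finsupp.single p 1)

lemma ofPath_comp {X Y Z : Presented R V rel} (p : Quiver.Path X.vertex Y.vertex)
    (q : Quiver.Path Y.vertex Z.vertex) :
    (ofPath (p.comp q) : X ⟶ Z) = ofPath p ≫ ofPath q := by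
  rw [ofPath, ← pathComp_single, ← homComp_toHom]
  rfl

lemma ofPath_cons {X Y Z : Presented R V rel} (p : Quiver.Path X.vertex Y.vertex)
    (e : Y.vertex ⟶ Z.vertex) : (ofPath (p.cons e) : X ⟶ Z) = ofPath p ≫ gen e :=
  ofPath_comp p e.toPath

lemma toHom_add (X Y : Presented R V rel) (x y : Quiver.Path X.vertex Y.vertex →₀ R) :
    (toHom X Y (x + y) : X ⟶ Y) = toHom X Y x + toHom X Y y :=
  map_add _ x y

lemma toHom_single (X Y : Presented R V rel) (p : Quiver.Path X.vertex Y.vertex) (r : R) :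
    (toHom X Y (Finsupp.single p r) : X ⟶ Y) = r • ofPath p := by
  rw [← Finsupp.smul_single_one]
  exact map_smul _ r _

lemma toHom_eq_zero_of_mem_rel {X Y : Presented R V rel}
    {y : Quiver.Path X.vertex Y.vertex →₀ R} (hy : y ∈ rel X.vertex Y.vertex) :
    toHom X Y y = 0 := by
  refine toHom_eq_zero_iff.2 (Submodule.subset_span
    ⟨_, _, Finsupp.single Quiver.Path.nil 1, y, Finsupp.single Quiver.Path.nil 1, hy, ?_⟩)
  rw [pathComp_nil_left, pathComp_nil_right]

lemma ofPath_eq_of_sub_mem_rel {X Y : Presented R V rel}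
    {p q : Quiver.Path X.vertex Y.vertex}
    (h : Finsupp.single p 1 - Finsupp.single q 1 ∈ rel X.vertex Y.vertex) :
    (ofPath p : X ⟶ Y) = ofPath q :=
  sub_eq_zero.1 (((toHom X Y).map_sub _ _).symm.trans (toHom_eq_zero_of_mem_rel h))

lemma hom_induction {X Y : Presented R V rel} {motive : (X ⟶ Y) → Prop} (f : X ⟶ Y)
    (zero : motive 0) (add : ∀ f g, motive f → motive g → motive (f + g))
    (smul_ofPath : ∀ (r : R) p, motive (r • ofPath p)) : motive f := by
  obtain ⟨x, rfl⟩ := toHom_surjective X Y f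
  induction x using Finsupp.induction_linear with
  | zero => simpa only [map_zero] using zero
  | add x y hx hy => exact toHom_add X Y x y ▸ add _ _ hx hy
  | single p r => exact toHom_single X Y p r ▸ smul_ofPath r p

section Membership

variable {C : Type} [Category.{u} C] [Preadditive C] [Linear R C] {P : MorphismProperty C}

lemma mem_of_mem_gen (F : Presented R V rel ⥤ C) [F.Additive] [F.Linear R]
    (hF : ∀ {X Y : Presented R V rel} (e : X.vertex ⟶ Y.vertex),
      GeneratedSubcategory.Mem R P (F.map (gen e : X ⟶ Y)))
    {X Y : Presented R V rel} (f : X ⟶ Y) : GeneratedSubcategory.Mem R P (F.map f) := by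
  have mem_ofPath : ∀ {b : V} (p : Quiver.Path X.vertex b),
      GeneratedSubcategory.Mem R P (F.map (ofPath p : X ⟶ ⟨b⟩)) := by
    intro b p
    induction p with
    | nil => exact (F.map_id X).symm ▸ .id _
    | @cons b _ p e ih =>
      rw [ofPath_cons (Y := ⟨b⟩) p e, F.map_comp]
      exact .comp _ _ ih (hF (X := ⟨b⟩) e)
  induction f using hom_induction with
  | zero => exact F.map_zero X Y ▸ .zero _ _
  | add f g hf hg => exact F.map_add ▸ .add _ _ hf hg
  | smul_ofPath r p => exact F.map_smul r _ ▸ .smul _ _ (mem_ofPath p)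

end Membership

section Lift

variable {C : Type*} [Category C] [Preadditive C] [Linear R C] (φ : V ⥤q C)

variable (R) in
/-- The linear extension of the evaluation of paths along a quiver morphism to a linear
category. -/
def evalPaths (a b : V) :
    (Quiver.Path a b →₀ R) →ₗ[R] (φ.obj a ⟶ φ.obj b) :=
  Finsupp.linearCombination R fun p => composePath (φ.mapPath p)

lemma evalPaths_single (a b : V) (p : Quiver.Path a b) (r : R) :
    evalPaths R φ a b (Finsupp.single p r) = r • composePath (φ.mapPath p) :=
  Finsupp.linearCombination_single R r p

lemma evalPaths_pathComp {a b c : V} (f : Quiver.Path a b →₀ R) (g : Quiver.Path b c →₀ R) :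
    evalPaths R φ a c (pathComp R a b c f g) = evalPaths R φ a b f ≫ evalPaths R φ b c g := by
  induction f using Finsupp.induction_linear with
  | zero => simp
  | add f₁ f₂ h₁ h₂ => simp only [map_add, LinearMap.add_apply, h₁, h₂, Preadditive.add_comp]
  | single p r =>
    induction g using Finsupp.induction_linear with
    | zero => simp
    | add g₁ g₂ h₁ h₂ => simp only [map_add, h₁, h₂, Preadditive.comp_add]
    | single q s =>
      simp only [pathComp, Finsupp.linearCombination_single, LinearMap.smul_apply, map_smul,
        evalPaths_single, one_smul, Prefunctor.mapPath_comp, composePath_comp,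
        Linear.smul_comp, Linear.comp_smul, smul_comm r s]

variable {φ} (hφ : ∀ a b, ∀ y ∈ rel a b, evalPaths R φ a b y = 0)

include hφ in
lemma ideal_le_ker_evalPaths (a b : V) : ideal rel a b ≤ LinearMap.ker (evalPaths R φ a b) := by
  refine Submodule.span_le.2 ?_
  rintro _ ⟨c, d, f, y, g, hy, rfl⟩
  change evalPaths R φ a b _ = 0
  rw [evalPaths_pathComp, evalPaths_pathComp, hφ c d y hy, Limits.comp_zero, Limits.zero_comp]

/-- The universal property of a presented category: a quiver morphism to a linear category whose
linear extension kills the relators induces a linear functor. -/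
def lift : Presented R V rel ⥤ C where
  obj X := φ.obj X.vertex
  map {X Y} f := (ideal rel X.vertex Y.vertex).liftQ (evalPaths R φ X.vertex Y.vertex)
    (ideal_le_ker_evalPaths hφ _ _) f
  map_id X := (evalPaths_single φ _ _ _ _).trans (one_smul _ _)
  map_comp {X Y Z} f g := by
    obtain ⟨f, rfl⟩ := toHom_surjective X Y f
    obtain ⟨g, rfl⟩ := toHom_surjective Y Z g
    exact evalPaths_pathComp φ f g

instance : (lift hφ).Additive where
  map_add := map_add _ _ _

instance : (lift hφ).Linear R where
  map_smul f r := map_smul _ r f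

lemma lift_map_ofPath {X Y : Presented R V rel} (p : Quiver.Path X.vertex Y.vertex) :
    (lift hφ).map (ofPath p : X ⟶ Y) = composePath (φ.mapPath p) :=
  (evalPaths_single φ _ _ _ _).trans (one_smul _ _)

end Lift

end

end Presented

namespace GeneratedSubcategory

variable {R : Type u} [CommRing R] {C : Type} [Category.{u} C] [Preadditive C] [Linear R C]
  {P : MorphismProperty C}

/-- The corestriction of a functor whose values lie in the generated subcategory. -/
def lift {D : Type*} [Category D] (F : D ⥤ C)
    (hF : ∀ {X Y : D} (f : X ⟶ Y), Mem R P (F.map f)) : D ⥤ GeneratedSubcategory R P where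
  obj X := ⟨F.obj X⟩
  map f := ⟨F.map f, hF f⟩
  map_id X := Subtype.ext (F.map_id X)
  map_comp f g := Subtype.ext (F.map_comp f g)

section Lift

variable {D : Type*} [Category D] [Preadditive D] (F : D ⥤ C) [F.Additive]

instance (hF : ∀ {X Y : D} (f : X ⟶ Y), Mem R P (F.map f)) : (lift F hF).Additive where
  map_add := Subtype.ext F.map_add

variable [Linear R D] [F.Linear R]

instance (hF : ∀ {X Y : D} (f : X ⟶ Y), Mem R P (F.map f)) : (lift F hF).Linear R where
  map_smul f r := Subtype.ext (F.map_smul r f)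

lemma exists_map_eq_of_mem (hobj : Function.Bijective F.obj)
    (hP : ∀ {X Y : D} (f : F.obj X ⟶ F.obj Y), P f → ∃ g : X ⟶ Y, F.map g = f) {X Y : D}
    {f : F.obj X ⟶ F.obj Y} (hf : Mem R P f) : ∃ g : X ⟶ Y, F.map g = f := by
  -- Composable pairs need not be of the form `F.obj X ⟶ F.obj Y ⟶ F.obj Z` on the nose.
  suffices h : ∀ {A B : C} {f : A ⟶ B}, Mem R P f → ∀ {X Y : D} (hX : F.obj X = A)
      (hY : F.obj Y = B), ∃ g : X ⟶ Y, F.map g = eqToHom hX ≫ f ≫ eqToHom hY.symm by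
    simpa using h hf rfl rfl
  intro A B f hf
  induction hf with
  | of f h =>
    rintro X Y rfl rfl
    simpa using hP f h
  | id A =>
    rintro X Y rfl hY
    obtain rfl := hobj.1 hY
    exact ⟨𝟙 _, by simp⟩
  | @comp A B C f g _ _ hf hg =>
    intro X Z hX hZ
    obtain ⟨Y, hY⟩ := hobj.2 B
    obtain ⟨f', hf'⟩ := hf hX hY
    obtain ⟨g', hg'⟩ := hg hY hZ
    exact ⟨f' ≫ g', by simp [hf', hg']⟩
  | zero A B => exact fun _ _ => ⟨0, by simp⟩
  | add f g _ _ hf hg =>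
    intro X Y hX hY
    obtain ⟨f', hf'⟩ := hf hX hY
    obtain ⟨g', hg'⟩ := hg hX hY
    exact ⟨f' + g', by simp [hf', hg', Functor.map_add]⟩
  | smul r f _ hf =>
    intro X Y hX hY
    obtain ⟨f', hf'⟩ := hf hX hY
    exact ⟨r • f', by simp [hf', Functor.map_smul]⟩

end Lift

end GeneratedSubcategory

namespace TypeA

noncomputable section

/-! ### Blocks and crossings -/

section

variable {n : ℕ} {c d d' : Composition n} {i j P a b e : ℕ}

lemma mem_subsetOf {j : Fin (n - 1)} : j ∈ subsetOf c ↔ ∀ m, c.sizeUpTo m ≠ j + 1 := by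
  have lo_lt : (j : ℕ) < c.sizeUpTo (c.index (lo j) + 1) := c.lt_sizeUpTo_index_succ (lo j)
  have hi_lt : (j : ℕ) + 1 < c.sizeUpTo (c.index (hi j) + 1) := c.lt_sizeUpTo_index_succ (hi j)
  have le_lo : c.sizeUpTo (c.index (lo j)) ≤ (j : ℕ) := c.sizeUpTo_index_le (lo j)
  have le_hi : c.sizeUpTo (c.index (hi j)) ≤ (j : ℕ) + 1 := c.sizeUpTo_index_le (hi j)
  rw [subsetOf, Finset.mem_filter_univ]
  constructor
  · intro h m hm
    rw [← h] at hi_lt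
    rcases Nat.lt_or_ge (c.index (lo j)) m with hlt | hge
    · have := c.monotone_sizeUpTo (show (c.index (lo j) : ℕ) + 1 ≤ m from hlt)
      omega
    · have := c.monotone_sizeUpTo hge
      omega
  · intro h
    by_contra hne
    rcases lt_or_gt_of_ne hne with hlt | hgt
    · have := c.monotone_sizeUpTo (show (c.index (lo j) : ℕ) + 1 ≤ c.index (hi j) from hlt)
      exact h _ (le_antisymm (this.trans le_hi) lo_lt)
    · have := c.monotone_sizeUpTo (show (c.index (hi j) : ℕ) + 1 ≤ c.index (lo j) from hgt)
      omega

lemma mem_boundaries_iff {v : Fin (n + 1)} :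
    v ∈ c.boundaries ↔ ∃ m, c.sizeUpTo m = v := by
  simp only [Composition.boundaries, Finset.mem_map, Finset.mem_univ, true_and]
  constructor
  · rintro ⟨i, rfl⟩
    exact ⟨i, rfl⟩
  · rintro ⟨m, hm⟩
    refine ⟨⟨min m c.length, by omega⟩, Fin.ext ?_⟩
    rw [← hm]
    rcases le_total m c.length with h | h
    · exact congrArg c.sizeUpTo (min_eq_left h)
    · exact (congrArg c.sizeUpTo (min_eq_right h)).trans
        (c.sizeUpTo_length.trans (c.sizeUpTo_ofLength_le m h).symm)

lemma subsetOf_injective : Function.Injective (subsetOf : Composition n → _) := by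
  intro c d h
  refine (compositionEquiv n).injective (CompositionAsSet.ext ?_)
  change c.boundaries = d.boundaries
  ext v
  by_cases h0 : v = 0
  · exact h0 ▸ iff_of_true c.toCompositionAsSet.zero_mem d.toCompositionAsSet.zero_mem
  by_cases hn : v = Fin.last n
  · exact hn ▸ iff_of_true c.toCompositionAsSet.getLast_mem d.toCompositionAsSet.getLast_mem
  have hpos : 0 < (v : ℕ) := Fin.pos_iff_ne_zero.2 h0
  have hlt : (v : ℕ) < n := Fin.val_lt_last hn
  have hv : (v : ℕ) - 1 + 1 = v := Nat.sub_add_cancel hpos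
  have key := Finset.ext_iff.1 h ⟨v - 1, by omega⟩
  rw [mem_subsetOf, mem_subsetOf] at key
  simpa only [mem_boundaries_iff, hv, not_forall, not_not] using not_congr key

lemma subsetOf_bijective : Function.Bijective (subsetOf : Composition n → _) := by
  rw [Fintype.bijective_iff_injective_and_card]
  refine ⟨subsetOf_injective, ?_⟩
  rw [composition_card, Fintype.card_finset, Fintype.card_fin]

lemma composition_ext_sizeUpTo (h : ∀ m, c.sizeUpTo m = d.sizeUpTo m) : c = d :=
  subsetOf_injective (Finset.ext fun _ => by simp only [mem_subsetOf, h])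

/-- The last letters of the blocks of `c` other than the last block, in increasing order. -/
def innerBoundary (c : Composition n) : Fin (c.length - 1) ↪o Fin (n - 1) :=
  OrderEmbedding.ofStrictMono
    (fun i => ⟨c.sizeUpTo (i + 1) - 1, by
      have h₁ : c.sizeUpTo i < c.sizeUpTo (i + 1) := c.sizeUpTo_strict_mono (by omega)
      have h₂ : c.sizeUpTo (i + 1) < c.sizeUpTo (i + 2) := c.sizeUpTo_strict_mono (by omega)
      have := c.sizeUpTo_le (i + 2)
      omega⟩)
    (fun i j hij => by
      have h₁ : c.sizeUpTo i < c.sizeUpTo (i + 1) := c.sizeUpTo_strict_mono (by omega)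
      have h₂ : c.sizeUpTo (i + 1) < c.sizeUpTo (i + 2) := c.sizeUpTo_strict_mono (by omega)
      have h₃ := c.monotone_sizeUpTo (show (i : ℕ) + 2 ≤ j + 1 from by
        have := Fin.lt_def.1 hij
        omega)
      exact Fin.lt_def.2 (by simp only; omega))

lemma innerBoundary_add_one (i : Fin (c.length - 1)) :
    (innerBoundary c i : ℕ) + 1 = c.sizeUpTo (i + 1) := by
  have : c.sizeUpTo i < c.sizeUpTo (i + 1) := c.sizeUpTo_strict_mono (by omega)
  exact Nat.sub_add_cancel (by omega)

lemma compl_subsetOf : (subsetOf c)ᶜ = Finset.univ.map (innerBoundary c).toEmbedding := by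
  ext j
  simp only [Finset.mem_compl, mem_subsetOf, not_forall, not_not, Finset.mem_map, Finset.mem_univ,
    true_and, RelEmbedding.coe_toEmbedding]
  constructor
  · rintro ⟨m, hm⟩
    have hm0 : m ≠ 0 := by
      rintro rfl
      simp at hm
    have hml : m < c.length := by
      by_contra! hge
      rw [c.sizeUpTo_ofLength_le m hge] at hm
      omega
    refine ⟨⟨m - 1, by omega⟩, Fin.ext ?_⟩
    have := innerBoundary_add_one (c := c) ⟨m - 1, by omega⟩
    simp only [Nat.sub_add_cancel (Nat.pos_of_ne_zero hm0)] at this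
    omega
  · rintro ⟨i, rfl⟩
    exact ⟨i + 1, (innerBoundary_add_one i).symm⟩

lemma card_compl_subsetOf (c : Composition n) : (subsetOf c)ᶜ.card = c.length - 1 := by
  rw [compl_subsetOf, Finset.card_map, Finset.card_fin]

lemma outer_subsetOf_add_one (hi : i < (subsetOf c)ᶜ.card) :
    (outer (subsetOf c) ⟨i, hi⟩ : ℕ) + 1 = c.sizeUpTo (i + 1) := by
  have hcard := card_compl_subsetOf c
  have h := Finset.orderEmbOfFin_unique (s := (subsetOf c)ᶜ) rfl
    (f := innerBoundary c ∘ Fin.cast hcard) (fun i => by simp [compl_subsetOf])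
    ((innerBoundary c).strictMono.comp (Fin.cast_strictMono hcard))
  rw [outer, ← congrFun h]
  exact innerBoundary_add_one _

/-- The blocks of `c` in positions `i` and `i + 1` have sizes `a` and `b`, and they are preceded
by `P` letters. Positivity of `a` and `b` ensures that both blocks exist. -/
structure AdjacentBlocks (c : Composition n) (i P a b : ℕ) : Prop where
  sizeUpTo_left : c.sizeUpTo i = P
  sizeUpTo_mid : c.sizeUpTo (i + 1) = P + a
  sizeUpTo_right : c.sizeUpTo (i + 2) = P + a + b
  left_pos : 0 < a
  right_pos : 0 < b

lemma exists_adjacentBlocks (h : i + 1 < c.length) : ∃ P a b, AdjacentBlocks c i P a b := by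
  have h₁ : c.sizeUpTo i < c.sizeUpTo (i + 1) := c.sizeUpTo_strict_mono (by omega)
  have h₂ : c.sizeUpTo (i + 1) < c.sizeUpTo (i + 2) := c.sizeUpTo_strict_mono (by omega)
  exact ⟨c.sizeUpTo i, c.sizeUpTo (i + 1) - c.sizeUpTo i, c.sizeUpTo (i + 2) - c.sizeUpTo (i + 1),
    by constructor <;> omega⟩

lemma exists_adjacentBlocks_of_notMem {s : Fin (n - 1)} (hs : s ∉ subsetOf c) :
    ∃ i P a b, AdjacentBlocks c i P a b ∧ (s : ℕ) + 1 = P + a := by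
  simp only [← Finset.mem_compl, compl_subsetOf, Finset.mem_map, Finset.mem_univ, true_and,
    RelEmbedding.coe_toEmbedding] at hs
  obtain ⟨i, rfl⟩ := hs
  obtain ⟨P, a, b, A⟩ := exists_adjacentBlocks (c := c) (i := i) (by omega)
  exact ⟨i, P, a, b, A, (innerBoundary_add_one i).trans A.sizeUpTo_mid⟩

namespace AdjacentBlocks

lemma le (A : AdjacentBlocks c i P a b) : P + a + b ≤ n :=
  A.sizeUpTo_right ▸ c.sizeUpTo_le _

lemma succ_lt_length (A : AdjacentBlocks c i P a b) : i + 1 < c.length := by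
  by_contra! h
  have h₁ := c.sizeUpTo_ofLength_le (i + 1) h
  have h₂ := c.sizeUpTo_ofLength_le (i + 2) (by omega)
  have := A.right_pos
  rw [A.sizeUpTo_mid] at h₁
  rw [A.sizeUpTo_right] at h₂
  omega

lemma sizeUpTo_trichotomy (A : AdjacentBlocks c i P a b) (m : ℕ) :
    c.sizeUpTo m ≤ P ∨ c.sizeUpTo m = P + a ∨ P + a + b ≤ c.sizeUpTo m := by
  rcases Nat.lt_trichotomy m (i + 1) with h | rfl | h
  · exact .inl (A.sizeUpTo_left ▸ c.monotone_sizeUpTo (by omega))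
  · exact .inr (.inl A.sizeUpTo_mid)
  · exact .inr (.inr (A.sizeUpTo_right ▸ c.monotone_sizeUpTo h))

lemma notMem_subsetOf (A : AdjacentBlocks c i P a b) {s : Fin (n - 1)}
    (hs : (s : ℕ) + 1 = P + a) : s ∉ subsetOf c :=
  fun h => mem_subsetOf.1 h (i + 1) (A.sizeUpTo_mid.trans hs.symm)

lemma mem_subsetOf_iff (A : AdjacentBlocks c i P a b) {s : Fin (n - 1)} (hl : P ≤ s)
    (hr : (s : ℕ) + 1 < P + a + b) : s ∈ subsetOf c ↔ (s : ℕ) + 1 ≠ P + a := by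
  refine ⟨fun h hs => A.notMem_subsetOf hs h, fun h => mem_subsetOf.2 fun m hm => ?_⟩
  have := A.sizeUpTo_trichotomy m
  omega

lemma outer_subsetOf (A : AdjacentBlocks c i P a b) : ∃ hi : i < (subsetOf c)ᶜ.card,
    (outer (subsetOf c) ⟨i, hi⟩ : ℕ) + 1 = P + a := by
  have := A.succ_lt_length
  have hi : i < (subsetOf c)ᶜ.card := by
    rw [card_compl_subsetOf]
    omega
  exact ⟨hi, (outer_subsetOf_add_one hi).trans A.sizeUpTo_mid⟩

end AdjacentBlocks

namespace IsCrossing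

lemma symm (h : IsCrossing i c d) : IsCrossing i d c := by
  obtain ⟨l, r, a, b, hl, hc, hd⟩ := h
  exact ⟨l, r, b, a, hl, hd, hc⟩

lemma sizeUpTo_of_ne (h : IsCrossing i c d) {m : ℕ} (hm : m ≠ i + 1) :
    d.sizeUpTo m = c.sizeUpTo m := by
  obtain ⟨l, r, a, b, rfl, hc, hd⟩ := h
  rw [Composition.sizeUpTo, Composition.sizeUpTo, hc, hd]
  rcases Nat.lt_or_ge l.length m with hlt | hle
  · obtain ⟨k, rfl⟩ : ∃ k, m = l.length + (k + 2) := ⟨m - l.length - 2, by omega⟩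
    simp only [List.take_length_add_append, List.take_succ_cons, List.sum_append, List.sum_cons]
    omega
  · rw [List.take_append_of_le_length hle, List.take_append_of_le_length hle]

lemma exists_adjacentBlocks (h : IsCrossing i c d) : ∃ P a b, AdjacentBlocks c i P a b := by
  refine TypeA.exists_adjacentBlocks ?_
  obtain ⟨l, r, a, b, rfl, hc, -⟩ := h
  rw [← c.blocks_length, hc]
  simp

lemma sizeUpTo_add_sizeUpTo (h : IsCrossing i c d) :
    d.sizeUpTo (i + 1) + c.sizeUpTo (i + 1) = c.sizeUpTo i + c.sizeUpTo (i + 2) := by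
  obtain ⟨l, r, a, b, rfl, hc, hd⟩ := h
  simp only [Composition.sizeUpTo, hc, hd, List.take_length_add_append, List.take_succ_cons,
    List.take_left, List.sum_append, List.sum_cons, List.take_zero, List.sum_nil]
  omega

lemma target_unique (h : IsCrossing i c d) (h' : IsCrossing i c d') : d = d' := by
  refine composition_ext_sizeUpTo fun m => ?_
  by_cases hm : m = i + 1
  · have := h.sizeUpTo_add_sizeUpTo
    have := h'.sizeUpTo_add_sizeUpTo
    subst hm
    omega
  · rw [h.sizeUpTo_of_ne hm, h'.sizeUpTo_of_ne hm]

end IsCrossing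

namespace AdjacentBlocks

lemma cross (A : AdjacentBlocks c i P a b) (h : IsCrossing i c d) : AdjacentBlocks d i P b a := by
  have hmid := h.sizeUpTo_add_sizeUpTo
  rw [A.sizeUpTo_left, A.sizeUpTo_mid, A.sizeUpTo_right] at hmid
  refine ⟨?_, by omega, ?_, A.right_pos, A.left_pos⟩
  · rw [h.sizeUpTo_of_ne (by omega), A.sizeUpTo_left]
  · rw [h.sizeUpTo_of_ne (by omega), A.sizeUpTo_right, add_right_comm]

lemma cross_far (A : AdjacentBlocks c j P a b) (h : IsCrossing i c d)
    (hij : i + 1 < j ∨ j + 1 < i) : AdjacentBlocks d j P a b := by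
  refine ⟨?_, ?_, ?_, A.left_pos, A.right_pos⟩
  · rw [h.sizeUpTo_of_ne (by omega), A.sizeUpTo_left]
  · rw [h.sizeUpTo_of_ne (by omega), A.sizeUpTo_mid]
  · rw [h.sizeUpTo_of_ne (by omega), A.sizeUpTo_right]

lemma exists_isCrossing (A : AdjacentBlocks c i P a b) : ∃ d, IsCrossing i c d := by
  obtain ⟨x, y, r, hr⟩ : ∃ x y r, c.blocks.drop i = x :: y :: r := by
    have hlen : (c.blocks.drop i).length = c.length - i := by simp
    have := A.succ_lt_length
    match h : c.blocks.drop i with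
    | [] | [_] =>
      simp only [h, List.length_cons, List.length_nil] at hlen
      omega
    | x :: y :: r => exact ⟨x, y, r, rfl⟩
  have hc : c.blocks = c.blocks.take i ++ x :: y :: r := by rw [← hr, List.take_append_drop]
  have hperm : (c.blocks.take i ++ y :: x :: r).Perm c.blocks := by
    conv_rhs => rw [hc]
    exact (List.Perm.swap x y r).append_left _
  refine ⟨⟨c.blocks.take i ++ y :: x :: r, fun hk => c.blocks_pos (hperm.mem_iff.1 hk),
    hperm.sum_eq.trans c.blocks_sum⟩, _, r, x, y, ?_, hc, rfl⟩
  have := A.succ_lt_length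
  rw [List.length_take, c.blocks_length]
  omega

end AdjacentBlocks

/-- The blocks of `c` in positions `i`, `i + 1` and `i + 2` have sizes `a`, `b` and `e`, and they
are preceded by `P` letters. -/
structure ThreeBlocks (c : Composition n) (i P a b e : ℕ) : Prop where
  left : AdjacentBlocks c i P a b
  right : AdjacentBlocks c (i + 1) (P + a) b e

lemma exists_threeBlocks (h : i + 2 < c.length) : ∃ P a b e, ThreeBlocks c i P a b e := by
  obtain ⟨P, a, b, A⟩ := exists_adjacentBlocks (c := c) (i := i) (by omega)
  obtain ⟨Q, b', e, B⟩ := exists_adjacentBlocks (c := c) (i := i + 1) (by omega)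
  obtain rfl : P + a = Q := A.sizeUpTo_mid.symm.trans B.sizeUpTo_left
  obtain rfl : b = b' := by simpa using A.sizeUpTo_right.symm.trans B.sizeUpTo_mid
  exact ⟨P, a, b, e, A, B⟩

namespace ThreeBlocks

lemma cross_left (T : ThreeBlocks c i P a b e) (h : IsCrossing i c d) :
    ThreeBlocks d i P b a e := by
  have A := T.left.cross h
  refine ⟨A, A.sizeUpTo_mid, A.sizeUpTo_right, ?_, T.left.left_pos, T.right.right_pos⟩
  rw [h.sizeUpTo_of_ne (by omega), T.right.sizeUpTo_right]
  omega

lemma cross_right (T : ThreeBlocks c i P a b e) (h : IsCrossing (i + 1) c d) :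
    ThreeBlocks d i P a e b := by
  have B := T.right.cross h
  refine ⟨⟨?_, B.sizeUpTo_left, B.sizeUpTo_mid, T.left.left_pos, T.right.right_pos⟩, B⟩
  rw [h.sizeUpTo_of_ne (by omega), T.left.sizeUpTo_left]

lemma le (T : ThreeBlocks c i P a b e) : P + a + b + e ≤ n := T.right.le

end ThreeBlocks

lemma IsCrossing.exists_hexagon {d₁ d₂ : Composition n} (h₁ : IsCrossing i d₁ d)
    (h₂ : IsCrossing (i + 1) d₂ d) : ∃ c₁ c₂ z : Composition n,
      IsCrossing i z c₁ ∧ IsCrossing (i + 1) c₁ d₁ ∧ IsCrossing (i + 1) z c₂ ∧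
      IsCrossing i c₂ d₂ := by
  obtain ⟨_, _, _, B⟩ := h₂.symm.exists_adjacentBlocks
  obtain ⟨P, a, b, e, T⟩ := exists_threeBlocks B.succ_lt_length
  have T₁ := T.cross_left h₁.symm
  have T₂ := T.cross_right h₂.symm
  obtain ⟨c₁, k₁⟩ := T₁.right.exists_isCrossing
  obtain ⟨c₂, k₂⟩ := T₂.left.exists_isCrossing
  have U₁ := T₁.cross_right k₁
  have U₂ := T₂.cross_left k₂
  obtain ⟨z, l₁⟩ := U₁.left.exists_isCrossing
  obtain ⟨z', l₂⟩ := U₂.right.exists_isCrossing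
  obtain rfl : z = z' := by
    have V₁ := U₁.cross_left l₁
    have V₂ := U₂.cross_right l₂
    refine composition_ext_sizeUpTo fun m => ?_
    by_cases hm₁ : m = i + 1
    · rw [hm₁, V₁.left.sizeUpTo_mid, V₂.left.sizeUpTo_mid]
    by_cases hm₂ : m = i + 1 + 1
    · rw [hm₂, V₁.right.sizeUpTo_mid, V₂.right.sizeUpTo_mid]
    rw [l₁.sizeUpTo_of_ne hm₁, k₁.sizeUpTo_of_ne hm₂, h₁.symm.sizeUpTo_of_ne hm₁,
      l₂.sizeUpTo_of_ne hm₂, k₂.sizeUpTo_of_ne hm₁, h₂.symm.sizeUpTo_of_ne hm₂]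
  exact ⟨c₁, c₂, z, l₁.symm, k₁.symm, l₂.symm, k₂.symm⟩

lemma IsCrossing.exists_square {d₁ d₂ : Composition n} (h₁ : IsCrossing i d₁ d)
    (h₂ : IsCrossing j d₂ d) (hij : i + 1 < j ∨ j + 1 < i) :
    ∃ z : Composition n, IsCrossing j z d₁ ∧ IsCrossing i z d₂ := by
  obtain ⟨P, a, b, A⟩ := h₁.symm.exists_adjacentBlocks
  obtain ⟨Q, e, f, B⟩ := h₂.symm.exists_adjacentBlocks
  obtain ⟨z, k⟩ := (B.cross_far h₁.symm hij).exists_isCrossing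
  obtain ⟨d', l⟩ := ((A.cross h₁.symm).cross_far k hij.symm).exists_isCrossing
  obtain rfl : d' = d₂ := by
    have A' := ((A.cross h₁.symm).cross_far k hij.symm).cross l
    have B' := ((B.cross_far h₁.symm hij).cross k).cross_far l hij
    refine composition_ext_sizeUpTo fun m => ?_
    by_cases hm₁ : m = i + 1
    · rw [hm₁, A'.sizeUpTo_mid, h₂.symm.sizeUpTo_of_ne (by omega), A.sizeUpTo_mid]
    by_cases hm₂ : m = j + 1
    · rw [hm₂, B'.sizeUpTo_mid, (B.cross h₂.symm).sizeUpTo_mid]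
    rw [l.sizeUpTo_of_ne hm₁, k.sizeUpTo_of_ne hm₂, h₁.symm.sizeUpTo_of_ne hm₁,
      h₂.symm.sizeUpTo_of_ne hm₂]
  exact ⟨z, k.symm, l⟩

end

/-! ### Block swaps -/

section

section

variable {n : ℕ} {J : Finset (Fin (n - 1))} {u : Equiv.Perm (Fin n)}

lemma mem_parabolic_iff : u ∈ parabolic J ↔ ∀ k ∉ J, ∀ z, u z ≤ lo k ↔ z ≤ lo k := by
  refine ⟨fun hu k hk => parabolic_le hu hk, fun h => ?_⟩
  induction hl : len u using Nat.strong_induction_on generalizing u with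
  | _ l ih =>
    by_cases hne : u = 1
    · exact hne ▸ Subgroup.one_mem _
    obtain ⟨i, hdesc⟩ := exists_descR hne
    have hiJ : i ∈ J := by
      by_contra hiJ
      have hlo := (h i hiJ (lo i)).2 le_rfl
      exact (lo_lt_hi i).not_ge ((h i hiJ (hi i)).1 (hdesc.le.trans hlo))
    have hlen := len_descR (i := i) (w := u) (by rw [ascR_iff]; exact hdesc.not_gt)
    have hmem : u * simple i ∈ parabolic J := ih _ (by omega) (fun k hk z => by
      rw [Equiv.Perm.mul_apply, h k hk, parabolic_le (simple_mem hiJ) hk]) rfl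
    exact (Subgroup.mul_mem_cancel_right _ (simple_mem hiJ)).1 hmem

lemma len_pos (h : u ≠ 1) : 0 < len u := by
  rw [Nat.pos_iff_ne_zero, ← len_reducedWord, Ne, List.length_eq_zero_iff]
  exact fun hw => h (by rw [← prod_reducedWord u, hw, List.map_nil, List.prod_nil])

end

/-- The map exchanging the intervals `[P, P + a)` and `[P + a, P + a + b)`, increasing on each. -/
def blockMove (P a b v : ℕ) : ℕ :=
  if v < P then v else if v < P + a then v + b else if v < P + a + b then v - a else v

section

variable {n P Q a b e f : ℕ}

lemma blockMove_of_lt {v : ℕ} (h : v < P) : blockMove P a b v = v := if_pos h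

lemma blockMove_left {v : ℕ} (h : P ≤ v) (h' : v < P + a) : blockMove P a b v = v + b := by
  rw [blockMove, if_neg (by omega), if_pos h']

lemma blockMove_right {v : ℕ} (h : P + a ≤ v) (h' : v < P + a + b) :
    blockMove P a b v = v - a := by
  rw [blockMove, if_neg (by omega), if_neg (by omega), if_pos h']

lemma blockMove_of_ge {v : ℕ} (h : P + a + b ≤ v) : blockMove P a b v = v := by
  rw [blockMove, if_neg (by omega), if_neg (by omega), if_neg (by omega)]

lemma blockMove_blockMove (P a b v : ℕ) : blockMove P b a (blockMove P a b v) = v := by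
  unfold blockMove
  split_ifs <;> omega

lemma blockMove_lt {v : ℕ} (h : P + a + b ≤ n) (hv : v < n) : blockMove P a b v < n := by
  unfold blockMove
  split_ifs <;> omega

/-- `blockMove` as a permutation of the letters. -/
def blockSwap (P a b : ℕ) (h : P + a + b ≤ n) : Equiv.Perm (Fin n) where
  toFun v := ⟨blockMove P a b v, blockMove_lt h v.2⟩
  invFun v := ⟨blockMove P b a v, blockMove_lt (by omega) v.2⟩
  left_inv v := Fin.ext (blockMove_blockMove P a b v)
  right_inv v := Fin.ext (blockMove_blockMove P b a v)

lemma blockSwap_val (h : P + a + b ≤ n) (v : Fin n) :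
    (blockSwap P a b h v : ℕ) = blockMove P a b v := rfl

lemma blockSwap_inv (h : P + a + b ≤ n) :
    (blockSwap P a b h)⁻¹ = blockSwap P b a (by omega) := rfl

lemma blockSwap_ne_one (h : P + a + b ≤ n) (ha : 0 < a) (hb : 0 < b) : blockSwap P a b h ≠ 1 := by
  intro h1
  have hP := congrArg Fin.val (Equiv.Perm.ext_iff.1 h1 ⟨P, by omega⟩)
  rw [blockSwap_val, blockMove_left le_rfl (Nat.lt_add_of_pos_right ha)] at hP
  exact hb.ne' (Nat.add_eq_left.1 hP)

lemma blockSwap_braid (h : P + a + b + e ≤ n) :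
    blockSwap P b e (by omega) * (blockSwap (P + b) a e (by omega) *
      blockSwap P a b (by omega)) =
    blockSwap (P + e) a b (by omega) * (blockSwap P a e (by omega) *
      blockSwap (P + a) b e h) := by
  ext v
  simp only [Equiv.Perm.mul_apply, blockSwap_val]
  grind (splits := 30) [blockMove]

lemma blockSwap_comm (h : P + a + b ≤ Q) (h' : Q + e + f ≤ n) :
    blockSwap P a b (by omega) * blockSwap Q e f h' =
      blockSwap Q e f h' * blockSwap P a b (by omega) := by
  ext v
  simp only [Equiv.Perm.mul_apply, blockSwap_val, blockMove]
  split_ifs <;> omega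

end

variable {n : ℕ}

/-- The permutation of the letters effected by the crossing of the blocks of `c` in positions `i`
and `i + 1`. -/
def crossPerm (c : Composition n) (i : ℕ) : Equiv.Perm (Fin n) :=
  blockSwap (c.sizeUpTo i) (c.sizeUpTo (i + 1) - c.sizeUpTo i)
    (c.sizeUpTo (i + 2) - c.sizeUpTo (i + 1)) (by
      have := c.monotone_sizeUpTo (Nat.le_add_right i 1)
      have := c.monotone_sizeUpTo (show i + 1 ≤ i + 2 by omega)
      have := c.sizeUpTo_le (i + 2)
      omega)

section

variable {c c₁ c₂ d d₁ d₂ : Composition n} {i j P a b : ℕ}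

lemma AdjacentBlocks.crossPerm_eq (A : AdjacentBlocks c i P a b) :
    crossPerm c i = blockSwap P a b A.le := by
  have h₁ : P + a - P = a := by omega
  have h₂ : P + a + b - (P + a) = b := by omega
  simp only [crossPerm, A.sizeUpTo_left, A.sizeUpTo_mid, A.sizeUpTo_right, h₁, h₂]

lemma AdjacentBlocks.crossPerm_val (A : AdjacentBlocks c i P a b) (v : Fin n) :
    (crossPerm c i v : ℕ) = blockMove P a b v := by
  rw [A.crossPerm_eq, blockSwap_val]

lemma IsCrossing.crossPerm_inv (h : IsCrossing i c d) : (crossPerm c i)⁻¹ = crossPerm d i := by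
  obtain ⟨P, a, b, A⟩ := h.exists_adjacentBlocks
  rw [A.crossPerm_eq, (A.cross h).crossPerm_eq, blockSwap_inv]

lemma IsCrossing.crossPerm_mul_crossPerm (h : IsCrossing i c d) (x : Equiv.Perm (Fin n)) :
    crossPerm d i * (crossPerm c i * x) = x := by
  rw [← h.crossPerm_inv, inv_mul_cancel_left]

lemma IsCrossing.crossPerm_ne_one (h : IsCrossing i c d) : crossPerm c i ≠ 1 := by
  obtain ⟨P, a, b, A⟩ := h.exists_adjacentBlocks
  rw [A.crossPerm_eq]
  exact blockSwap_ne_one A.le A.left_pos A.right_pos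

lemma crossPerm_braid (h₁ : IsCrossing i c c₁) (h₂ : IsCrossing (i + 1) c₁ c₂)
    (k₁ : IsCrossing (i + 1) c d₁) (k₂ : IsCrossing i d₁ d₂) :
    crossPerm c₂ i * (crossPerm c₁ (i + 1) * crossPerm c i) =
      crossPerm d₂ (i + 1) * (crossPerm d₁ i * crossPerm c (i + 1)) := by
  obtain ⟨_, _, _, A⟩ := k₁.exists_adjacentBlocks
  obtain ⟨P, a, b, e, T⟩ := exists_threeBlocks A.succ_lt_length
  have T₁ := T.cross_left h₁
  have U₁ := T.cross_right k₁
  rw [T.left.crossPerm_eq, T₁.right.crossPerm_eq, (T₁.cross_right h₂).left.crossPerm_eq,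
    T.right.crossPerm_eq, U₁.left.crossPerm_eq, (U₁.cross_left k₂).right.crossPerm_eq]
  exact blockSwap_braid T.le

lemma crossPerm_comm (hij : i + 1 < j ∨ j + 1 < i) (h : IsCrossing j c c₁)
    (k : IsCrossing i c d₁) :
    crossPerm c₁ i * crossPerm c j = crossPerm d₁ j * crossPerm c i := by
  wlog hlt : i + 1 < j generalizing i j c₁ d₁
  · exact (this hij.symm k h (hij.resolve_left hlt)).symm
  obtain ⟨P, a, b, A⟩ := k.exists_adjacentBlocks
  obtain ⟨Q, e, f, B⟩ := h.exists_adjacentBlocks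
  rw [A.crossPerm_eq, B.crossPerm_eq, (A.cross_far h hij.symm).crossPerm_eq,
    (B.cross_far k hij).crossPerm_eq]
  refine blockSwap_comm ?_ B.le
  rw [← A.sizeUpTo_right, ← B.sizeUpTo_left]
  exact c.monotone_sizeUpTo hlt

end

end

/-! ### Block permutations -/

section

section

variable {n : ℕ} {I J K : Finset (Fin (n - 1))} {x y : Equiv.Perm (Fin n)}

/-- `x` maps the pairs of adjacent letters exchanged by `J` increasingly onto the pairs exchanged
by `I`. For the subsets `J` and `I` of two compositions this says that `x` moves the blocks of the
first onto those of the second as rigid intervals. -/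
def IsBlockPerm (J I : Finset (Fin (n - 1))) (x : Equiv.Perm (Fin n)) : Prop :=
  (∀ j ∈ J, ∃ i ∈ I, x (lo j) = lo i ∧ x (hi j) = hi i) ∧
    ∀ i ∈ I, ∃ j ∈ J, x (lo j) = lo i ∧ x (hi j) = hi i

namespace IsBlockPerm

lemma one (J : Finset (Fin (n - 1))) : IsBlockPerm J J 1 :=
  ⟨fun j hj => ⟨j, hj, rfl, rfl⟩, fun j hj => ⟨j, hj, rfl, rfl⟩⟩

lemma mul (hx : IsBlockPerm J I x) (hy : IsBlockPerm K J y) : IsBlockPerm K I (x * y) := by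
  constructor
  · intro k hk
    obtain ⟨j, hj, hlo, hhi⟩ := hy.1 k hk
    obtain ⟨i, hi, hlo', hhi'⟩ := hx.1 j hj
    exact ⟨i, hi, (congrArg x hlo).trans hlo', (congrArg x hhi).trans hhi'⟩
  · intro i hi
    obtain ⟨j, hj, hlo, hhi⟩ := hx.2 i hi
    obtain ⟨k, hk, hlo', hhi'⟩ := hy.2 j hj
    exact ⟨k, hk, (congrArg x hlo').trans hlo, (congrArg x hhi').trans hhi⟩

lemma inv (h : IsBlockPerm J I x) : IsBlockPerm I J x⁻¹ := by
  constructor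
  · intro i hi
    obtain ⟨j, hj, hlo, hhi⟩ := h.2 i hi
    exact ⟨j, hj, Equiv.Perm.inv_eq_iff_eq.2 hlo.symm, Equiv.Perm.inv_eq_iff_eq.2 hhi.symm⟩
  · intro j hj
    obtain ⟨i, hi, hlo, hhi⟩ := h.1 j hj
    exact ⟨i, hi, Equiv.Perm.inv_eq_iff_eq.2 hlo.symm, Equiv.Perm.inv_eq_iff_eq.2 hhi.symm⟩

lemma eq_of_one (h : IsBlockPerm J I 1) : J = I := by
  have lo_inj {j i : Fin (n - 1)} (hji : lo j = lo i) : j = i := Fin.ext (Fin.mk.inj hji)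
  ext k
  constructor
  · intro hk
    obtain ⟨i, hi, hlo, -⟩ := h.1 k hk
    exact lo_inj hlo ▸ hi
  · intro hk
    obtain ⟨j, hj, hlo, -⟩ := h.2 k hk
    exact lo_inj hlo ▸ hj

lemma lt (h : IsBlockPerm J I x) : ∀ j ∈ J, x (lo j) < x (hi j) := by
  intro j hj
  obtain ⟨i, -, hlo, hhi⟩ := h.1 j hj
  rw [hlo, hhi]
  exact lo_lt_hi i

lemma exists_mul_simple (h : IsBlockPerm J I x) {i : Fin (n - 1)} (hi : i ∈ I) :
    ∃ j ∈ J, x * simple j = simple i * x := by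
  obtain ⟨j, hj, hlo, hhi⟩ := h.2 i hi
  exact ⟨j, hj, by rw [simple, simple, ← hlo, ← hhi, Equiv.mul_swap_eq_swap_mul]⟩

lemma apply_eq_add (h : IsBlockPerm J I x) {u v : Fin n} {k : ℕ} (hv : (v : ℕ) = u + k)
    (hJ : ∀ j : Fin (n - 1), (u : ℕ) ≤ j → (j : ℕ) < v → j ∈ J) : (x v : ℕ) = x u + k := by
  induction k generalizing v with
  | zero => rw [Fin.ext hv, add_zero]
  | succ k ih =>
    have := v.2
    obtain ⟨i, -, hlo, hhi⟩ := h.1 ⟨u + k, by omega⟩ (hJ _ (by simp) (by simp [hv]))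
    have hlast := ih (v := lo ⟨u + k, by omega⟩) rfl fun j hj hjk =>
      hJ j hj (hjk.trans (by simp [lo, hv]))
    rw [show v = hi ⟨u + k, by omega⟩ from Fin.ext (by simp [hi, hv, add_assoc]), hhi,
      ← add_assoc, ← hlast, hlo]
    rfl

end IsBlockPerm

end

variable {n : ℕ} {c d : Composition n} {i P a b : ℕ}

lemma IsCrossing.exists_mem_subsetOf (h : IsCrossing i c d) {j : Fin (n - 1)}
    (hj : j ∈ subsetOf c) :
    ∃ k ∈ subsetOf d, crossPerm c i (lo j) = lo k ∧ crossPerm c i (hi j) = hi k := by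
  obtain ⟨P, a, b, A⟩ := h.exists_adjacentBlocks
  have hjn := j.2
  have hj' := mem_subsetOf.1 hj
  have hP : P ≠ j + 1 := A.sizeUpTo_left ▸ hj' i
  have hPa : P + a ≠ j + 1 := A.sizeUpTo_mid ▸ hj' (i + 1)
  have hPab : P + a + b ≠ j + 1 := A.sizeUpTo_right ▸ hj' (i + 2)
  suffices ∃ k ∈ subsetOf d, blockMove P a b j = k ∧ blockMove P a b (j + 1) = k + 1 by
    obtain ⟨k, hk, hlo, hhi⟩ := this
    exact ⟨k, hk, Fin.ext ((A.crossPerm_val _).trans hlo), Fin.ext ((A.crossPerm_val _).trans hhi)⟩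
  have outside (hout : (j : ℕ) + 1 < P ∨ P + a + b ≤ j) : j ∈ subsetOf d := by
    refine mem_subsetOf.2 fun m => ?_
    by_cases hm : m = i + 1
    · rw [hm, (A.cross h).sizeUpTo_mid]
      omega
    · rw [h.sizeUpTo_of_ne hm]
      exact hj' m
  have hPn := A.le
  rcases lt_or_ge (j : ℕ) P with hlt | hge
  · exact ⟨j, outside (.inl (by omega)), blockMove_of_lt hlt, blockMove_of_lt (by omega)⟩
  rcases lt_or_ge (j : ℕ) (P + a) with hlt | hge'
  · refine ⟨⟨j + b, by omega⟩,
      ((A.cross h).mem_subsetOf_iff (by simp only; omega) (by simp only; omega)).2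
        (by simp only; omega), blockMove_left hge hlt, ?_⟩
    rw [blockMove_left (by omega) (by omega), add_right_comm]
  rcases lt_or_ge (j : ℕ) (P + a + b) with hlt | hge'
  · refine ⟨⟨j - a, by omega⟩,
      ((A.cross h).mem_subsetOf_iff (by simp only; omega) (by simp only; omega)).2
        (by simp only; omega), blockMove_right (by omega) hlt, ?_⟩
    rw [blockMove_right (by omega) (by omega)]
    simp only
    omega
  · exact ⟨j, outside (.inr hge'), blockMove_of_ge hge', blockMove_of_ge (by omega)⟩

lemma IsCrossing.isBlockPerm_crossPerm (h : IsCrossing i c d) :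
    IsBlockPerm (subsetOf c) (subsetOf d) (crossPerm c i) := by
  refine ⟨fun j hj => h.exists_mem_subsetOf hj, fun k hk => ?_⟩
  obtain ⟨j, hj, hlo, hhi⟩ := h.symm.exists_mem_subsetOf hk
  rw [← h.crossPerm_inv] at hlo hhi
  exact ⟨j, hj, (Equiv.Perm.inv_eq_iff_eq.1 hlo).symm, (Equiv.Perm.inv_eq_iff_eq.1 hhi).symm⟩

/-- If `x` moves blocks onto the blocks of `c`, the first letter of the block that it moves to
position `m`. The value is `0` if `c` has no block in position `m`. -/
def blockStart (c : Composition n) (x : Equiv.Perm (Fin n)) (m : ℕ) : ℕ :=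
  if h : c.sizeUpTo m < n then x⁻¹ ⟨c.sizeUpTo m, h⟩ else 0

section

variable {x : Equiv.Perm (Fin n)} {J : Finset (Fin (n - 1))}

lemma blockStart_eq {m : ℕ} {v : Fin n} (h : c.sizeUpTo m = v) : blockStart c x m = x⁻¹ v := by
  rw [blockStart, dif_pos (h ▸ v.2)]
  simp only [h]

lemma blockStart_one_lt (h : i + 1 < c.length) : blockStart c 1 i < blockStart c 1 (i + 1) := by
  obtain ⟨P, a, b, A⟩ := exists_adjacentBlocks h
  have hPn := A.le
  have ha := A.left_pos
  have hb := A.right_pos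
  rw [blockStart_eq (v := ⟨P, by omega⟩) A.sizeUpTo_left,
    blockStart_eq (v := ⟨P + a, by omega⟩) A.sizeUpTo_mid]
  simpa using ha

lemma blockStart_ne (h : i + 1 < c.length) (x : Equiv.Perm (Fin n)) :
    blockStart c x i ≠ blockStart c x (i + 1) := by
  obtain ⟨P, a, b, A⟩ := exists_adjacentBlocks h
  have hPn := A.le
  have ha := A.left_pos
  have hb := A.right_pos
  rw [blockStart_eq (v := ⟨P, by omega⟩) A.sizeUpTo_left,
    blockStart_eq (v := ⟨P + a, by omega⟩) A.sizeUpTo_mid]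
  refine fun heq => ha.ne' ?_
  simpa using x⁻¹.injective (Fin.ext heq)

lemma IsCrossing.sizeUpTo_eq_blockMove (h : IsCrossing i c d) (A : AdjacentBlocks c i P a b)
    (m : ℕ) : d.sizeUpTo m = blockMove P a b (c.sizeUpTo (Equiv.swap i (i + 1) m)) := by
  have B := A.cross h
  have ha := A.left_pos
  have hb := A.right_pos
  have hlen := A.succ_lt_length
  rcases lt_trichotomy m i with hlt | rfl | hgt
  · have hm : c.sizeUpTo m < c.sizeUpTo (m + 1) := c.sizeUpTo_strict_mono (by omega)
    have hmi := c.monotone_sizeUpTo (show m + 1 ≤ i from hlt)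
    rw [Equiv.swap_apply_of_ne_of_ne (by omega) (by omega), h.sizeUpTo_of_ne (by omega),
      blockMove_of_lt (by rw [A.sizeUpTo_left] at hmi; omega)]
  · rw [Equiv.swap_apply_left, B.sizeUpTo_left, A.sizeUpTo_mid,
      blockMove_right le_rfl (by omega), Nat.add_sub_cancel]
  · rcases eq_or_lt_of_le (show i + 1 ≤ m from hgt) with rfl | hgt'
    · rw [Equiv.swap_apply_right, B.sizeUpTo_mid, A.sizeUpTo_left,
        blockMove_left le_rfl (by omega)]
    · rw [Equiv.swap_apply_of_ne_of_ne (by omega) (by omega), h.sizeUpTo_of_ne (by omega),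
        blockMove_of_ge (A.sizeUpTo_right ▸ c.monotone_sizeUpTo hgt')]

lemma IsCrossing.blockStart_crossPerm_mul (h : IsCrossing i c d) (x : Equiv.Perm (Fin n)) (m : ℕ) :
    blockStart d (crossPerm c i * x) m = blockStart c x (Equiv.swap i (i + 1) m) := by
  obtain ⟨P, a, b, A⟩ := h.exists_adjacentBlocks
  have hstart := h.sizeUpTo_eq_blockMove A m
  by_cases hm : c.sizeUpTo (Equiv.swap i (i + 1) m) < n
  · rw [blockStart_eq (v := ⟨_, hm⟩) rfl, blockStart_eq (v := crossPerm c i ⟨_, hm⟩)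
      (hstart.trans (A.crossPerm_val ⟨_, hm⟩).symm), mul_inv_rev,
      Equiv.Perm.mul_apply, ← Equiv.Perm.mul_apply _ (crossPerm c i), inv_mul_cancel,
      Equiv.Perm.one_apply]
  · have hge := A.le.trans (not_lt.1 hm)
    rw [blockStart, blockStart, dif_neg hm, dif_neg (by rwa [hstart, blockMove_of_ge hge])]

lemma IsBlockPerm.inv_lt_inv_iff (hx : IsBlockPerm J (subsetOf c) x)
    (A : AdjacentBlocks c i P a b) {s : Fin (n - 1)} (hs : (s : ℕ) + 1 = P + a) :
    x⁻¹ (lo s) < x⁻¹ (hi s) ↔ blockStart c x i < blockStart c x (i + 1) := by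
  have := s.2
  have ha := A.left_pos
  rw [blockStart_eq (v := ⟨P, by omega⟩) A.sizeUpTo_left,
    blockStart_eq (v := hi s) (A.sizeUpTo_mid.trans hs.symm)]
  have rigid (v : Fin n) (hP : P ≤ v) (hv : (v : ℕ) < P + a) :
      (x⁻¹ v : ℕ) = x⁻¹ ⟨P, by omega⟩ + (v - P) := by
    refine hx.inv.apply_eq_add (by simp only; omega) fun j hj hjv => ?_
    simp only at hj
    exact (A.mem_subsetOf_iff hj (by omega)).2 (by omega)
  have hlo := rigid (lo s) (by simp only [lo]; omega) (by simp only [lo]; omega)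
  simp only [lo] at hlo
  rw [Fin.lt_def]
  simp only [lo]
  refine ⟨by omega, fun hlt => ?_⟩
  by_contra! hle
  obtain ⟨k, hk⟩ := Nat.exists_eq_add_of_lt hlt
  have hcoin := rigid ⟨P + (k + 1), by omega⟩ (by simp) (by simp only; omega)
  simp only at hcoin
  have heq : x⁻¹ ⟨P + (k + 1), by omega⟩ = x⁻¹ (hi s) := Fin.ext (by omega)
  have hval : P + (k + 1) = s + 1 := Fin.mk.inj (x⁻¹.injective heq)
  omega

lemma AdjacentBlocks.crossPerm_mem_parabolic (A : AdjacentBlocks c i P a b) {s : Fin (n - 1)}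
    (hs : (s : ℕ) + 1 = P + a) : crossPerm c i ∈ parabolic (insert s (subsetOf c)) := by
  refine mem_parabolic_iff.2 fun k hk z => ?_
  rw [Finset.mem_insert, not_or, mem_subsetOf, not_forall_not] at hk
  obtain ⟨hks, m, hm⟩ := hk
  have hks : (k : ℕ) ≠ s := Fin.val_ne_of_ne hks
  have := A.sizeUpTo_trichotomy m
  rw [Fin.le_def, Fin.le_def, A.crossPerm_val]
  simp only [lo]
  unfold blockMove
  split_ifs <;> omega

lemma IsBlockPerm.len_crossPerm_mul (hx : IsBlockPerm J (subsetOf c) x) (h : i + 1 < c.length)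
    (hlt : blockStart c x i < blockStart c x (i + 1)) :
    len (crossPerm c i * x) = len (crossPerm c i) + len x := by
  obtain ⟨P, a, b, A⟩ := exists_adjacentBlocks h
  have hPn := A.le
  have ha := A.left_pos
  have hb := A.right_pos
  obtain ⟨s, hs⟩ : ∃ s : Fin (n - 1), (s : ℕ) + 1 = P + a :=
    ⟨⟨P + a - 1, by omega⟩, by simp only; omega⟩
  have hasc : ∀ j ∈ insert s (subsetOf c), x⁻¹ (lo j) < x⁻¹ (hi j) := by
    intro j hj
    rcases Finset.mem_insert.1 hj with rfl | hj
    · exact (hx.inv_lt_inv_iff A hs).2 hlt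
    · exact hx.inv.lt j hj
  have hlen := len_mul_parabolic hasc (Subgroup.inv_mem _ (A.crossPerm_mem_parabolic hs))
  rwa [← mul_inv_rev, len_inv, len_inv, len_inv, add_comm] at hlen

lemma IsBlockPerm.len_eq_of_gt (hx : IsBlockPerm J (subsetOf c) x) (h : IsCrossing i c d)
    (hgt : blockStart c x (i + 1) < blockStart c x i) :
    len x = len (crossPerm d i) + len (crossPerm c i * x) := by
  obtain ⟨P, a, b, A⟩ := h.exists_adjacentBlocks
  have hlen := (h.isBlockPerm_crossPerm.mul hx).len_crossPerm_mul (A.cross h).succ_lt_length (by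
    rwa [h.blockStart_crossPerm_mul, h.blockStart_crossPerm_mul, Equiv.swap_apply_left,
      Equiv.swap_apply_right])
  rwa [h.crossPerm_mul_crossPerm] at hlen

lemma IsBlockPerm.len_crossPerm_mul_iff (hx : IsBlockPerm J (subsetOf c) x)
    (h : IsCrossing i c d) :
    len (crossPerm c i * x) = len (crossPerm c i) + len x ↔
      blockStart c x i < blockStart c x (i + 1) := by
  obtain ⟨P, a, b, A⟩ := h.exists_adjacentBlocks
  refine ⟨fun hlen => ?_, hx.len_crossPerm_mul A.succ_lt_length⟩
  by_contra! hle
  have := hx.len_eq_of_gt h (hle.lt_of_ne (blockStart_ne A.succ_lt_length x).symm)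
  have := len_pos h.crossPerm_ne_one
  omega

lemma IsBlockPerm.exists_isCrossing_gt (hx : IsBlockPerm J (subsetOf c) x) (hne : x ≠ 1) :
    ∃ i d, IsCrossing i c d ∧ blockStart c x (i + 1) < blockStart c x i := by
  obtain ⟨s, hdesc⟩ := exists_descR (inv_ne_one.2 hne)
  have hs : s ∉ subsetOf c := fun hs => hdesc.not_gt (hx.inv.lt s hs)
  obtain ⟨i, P, a, b, A, hPa⟩ := exists_adjacentBlocks_of_notMem hs
  obtain ⟨d, h⟩ := A.exists_isCrossing
  refine ⟨i, d, h, ?_⟩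
  have hle := (hx.inv_lt_inv_iff A hPa).not.1 hdesc.not_gt
  exact (not_lt.1 hle).lt_of_ne (blockStart_ne A.succ_lt_length x).symm

end

end

/-! ### Cosets of block permutations -/

section

variable {n : ℕ} {I J K M : Finset (Fin (n - 1))} {v x y : Equiv.Perm (Fin n)}

lemma eq_longest_of_absL (hv : v ∈ parabolic M) (h : AbsL M v) : v = longest M := by
  rw [← star_absL h (longest_mem M), star_absR (absR_longest M) hv]

lemma eq_longest_of_absR (hv : v ∈ parabolic M) (h : AbsR M v) : v = longest M := by
  rw [← star_absR h (longest_mem M), star_absL (absL_longest M) hv]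

lemma longest_mul_longest (M : Finset (Fin (n - 1))) : longest M * longest M = 1 := by
  nth_rewrite 1 [← longest_inv]
  exact inv_mul_cancel _

lemma longest_mul_longest_mul (M : Finset (Fin (n - 1))) (x : Equiv.Perm (Fin n)) :
    longest M * (longest M * x) = x := by
  rw [← mul_assoc, longest_mul_longest, one_mul]

lemma exists_simple_eq_longest_conj {s : Fin (n - 1)} (hs : s ∈ M) :
    ∃ t ∈ M, simple t = longest M * simple s * longest M := by
  have hmem : longest M * simple s ∈ parabolic M :=
    Subgroup.mul_mem _ (longest_mem M) (simple_mem hs)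
  have hlen : len (longest M * simple s) + 1 = len (longest M) :=
    (len_descR fun hasc => hasc.not_ge (len_le_longest hmem)).symm
  obtain ⟨t, ht, hasc⟩ : ∃ t ∈ M, starLeft t (longest M * simple s) ≠ longest M * simple s := by
    by_contra! habs
    have := congrArg len (eq_longest_of_absL hmem habs)
    omega
  have hlt : len (longest M * simple s) < len (simple t * (longest M * simple s)) := by
    by_contra hge
    exact hasc (if_neg hge)
  have htop : simple t * (longest M * simple s) = longest M := by
    refine eq_longest_of_absL (Subgroup.mul_mem _ (simple_mem ht) hmem) fun i hi => if_neg ?_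
    have := len_le_longest (Subgroup.mul_mem _ (simple_mem hi)
      (Subgroup.mul_mem _ (simple_mem ht) hmem))
    omega
  exact ⟨t, ht, by
    rw [eq_mul_inv_of_mul_eq htop, mul_inv_rev, longest_inv, simple_inv, mul_assoc]⟩

lemma simple_injective : Function.Injective (simple : Fin (n - 1) → Equiv.Perm (Fin n)) := by
  intro i j hij
  by_contra hne
  have hle := (parabolic_le (simple_mem (Finset.mem_singleton_self j))
    (mt Finset.mem_singleton.1 hne) (lo i)).2 le_rfl
  rw [← hij, simple_lo] at hle
  exact hle.not_gt (lo_lt_hi i)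

lemma Coset.mk_mul_longest (x : Equiv.Perm (Fin n)) :
    Coset.mk I J (x * longest J) = Coset.mk I J x := by
  rw [eq_comm, Coset.mk_eq_iff]
  exact ⟨1, Subgroup.one_mem _, _, longest_mem J, by rw [one_mul]⟩

namespace IsBlockPerm

lemma max_mk (hx : IsBlockPerm J I x) : (Coset.mk I J x).max = x * longest J := by
  rw [← Coset.mk_mul_longest]
  have le_top : ∀ v ∈ parabolic J, len (x * v) ≤ len (x * longest J) := fun v hv => by
    rw [len_mul_parabolic hx.lt hv, len_mul_parabolic hx.lt (longest_mem J)]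
    exact Nat.add_le_add_left (len_le_longest hv) _
  refine Coset.max_mk_of_abs (fun i hi => if_neg (not_lt.2 ?_))
    (fun j hj => if_neg (not_lt.2 ?_))
  · obtain ⟨j, hj, hcomm⟩ := hx.exists_mul_simple hi
    rw [← mul_assoc, ← hcomm, mul_assoc]
    exact le_top _ (Subgroup.mul_mem _ (simple_mem hj) (longest_mem J))
  · rw [mul_assoc]
    exact le_top _ (Subgroup.mul_mem _ (longest_mem J) (simple_mem hj))

lemma eq_of_mk_eq (hx : IsBlockPerm J I x) (hy : IsBlockPerm J I y)
    (h : Coset.mk I J x = Coset.mk I J y) : x = y := by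
  have hmax := congrArg Coset.max h
  rw [hx.max_mk, hy.max_mk] at hmax
  exact mul_right_cancel hmax

lemma star_max (hx : IsBlockPerm J I x) (hy : IsBlockPerm K J y) :
    star (Coset.mk I J x).max (Coset.mk J K y).max = star (star x y) (longest K) := by
  rw [hx.max_mk, ← star_eq_mul_of_len' (len_mul_parabolic hx.lt (longest_mem J)), star_assoc,
    star_absL (absL_max (Coset.mk J K y)) (longest_mem J), hy.max_mk,
    ← star_eq_mul_of_len' (len_mul_parabolic hy.lt (longest_mem K)), star_assoc]

lemma isReduced_iff (hx : IsBlockPerm J I x) (hy : IsBlockPerm K J y) :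
    (Coset.mk I J x).IsReduced (Coset.mk J K y) ↔ len (x * y) = len x + len y := by
  rw [Coset.isReduced_iff, hx.star_max hy, hx.max_mk, hy.max_mk,
    len_mul_parabolic hx.lt (longest_mem J), len_mul_parabolic hy.lt (longest_mem K)]
  constructor
  · intro h
    have hstar := len_star_le x y
    have hstar' := len_star_le (star x y) (longest K)
    have hlen : len (star x y) = len x + len y := by omega
    rw [← star_eq_mul_of_len hlen, hlen]
  · intro h
    have hxy := len_mul_parabolic (hx.mul hy).lt (longest_mem K)
    rw [star_eq_mul_of_len' h, star_eq_mul_of_len' hxy, hxy]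
    omega

lemma star_mk (hx : IsBlockPerm J I x) (hy : IsBlockPerm K J y)
    (h : len (x * y) = len x + len y) :
    (Coset.mk I J x).star (Coset.mk J K y) = Coset.mk I K (x * y) := by
  rw [Coset.star, hx.star_max hy, star_eq_mul_of_len' h,
    star_eq_mul_of_len' (len_mul_parabolic (hx.mul hy).lt (longest_mem K)),
    Coset.mk_mul_longest]

end IsBlockPerm

end

section

variable {n : ℕ} {c d : Composition n} {i P a b : ℕ} {s t : Fin (n - 1)}

lemma lt_sizeUpTo_iff_of_mem_parabolic {u : Equiv.Perm (Fin n)} (hu : u ∈ parabolic (subsetOf c))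
    (m : ℕ) (z : Fin n) : (u z : ℕ) < c.sizeUpTo m ↔ (z : ℕ) < c.sizeUpTo m := by
  have hle := c.sizeUpTo_le m
  rcases Nat.eq_zero_or_pos (c.sizeUpTo m) with h0 | hpos
  · rw [h0]
    exact iff_of_false (Nat.not_lt_zero _) (Nat.not_lt_zero _)
  rcases hle.eq_or_lt with hn | hlt
  · rw [hn]
    exact iff_of_true (u z).2 z.2
  have hk : (⟨c.sizeUpTo m - 1, by omega⟩ : Fin (n - 1)) ∉ subsetOf c := fun h =>
    mem_subsetOf.1 h m (by simp only; omega)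
  have hiff := parabolic_le hu hk z
  simp only [lo, Fin.le_def] at hiff
  omega

namespace AdjacentBlocks

lemma longest_insert (A : AdjacentBlocks c i P a b) (h : IsCrossing i c d)
    (hs : (s : ℕ) + 1 = P + a) :
    longest (insert s (subsetOf c)) = crossPerm c i * longest (subsetOf c) := by
  have hmono : parabolic (subsetOf c) ≤ parabolic (insert s (subsetOf c)) :=
    fun u hu => mem_parabolic_iff.2 fun k hk =>
      mem_parabolic_iff.1 hu k fun hkc => hk (Finset.mem_insert_of_mem hkc)
  symm
  refine eq_longest_of_absR (Subgroup.mul_mem _ (A.crossPerm_mem_parabolic hs)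
    (hmono (longest_mem _))) fun j hj => ?_
  rcases Finset.mem_insert.1 hj with rfl | hj
  · have bounds := lt_sizeUpTo_iff_of_mem_parabolic (longest_mem (subsetOf c))
    have hP := A.sizeUpTo_left ▸ bounds i (lo j)
    have hPa_lo := A.sizeUpTo_mid ▸ bounds (i + 1) (lo j)
    have hPa_hi := A.sizeUpTo_mid ▸ bounds (i + 1) (hi j)
    have hPab := A.sizeUpTo_right ▸ bounds (i + 2) (hi j)
    have ha := A.left_pos
    have hb := A.right_pos
    have hlo : (lo j : ℕ) = j := rfl
    have hhi : (hi j : ℕ) = j + 1 := rfl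
    refine if_neg (ascR_iff.not.2 (not_lt.2 (Fin.le_def.2 ?_)))
    rw [Equiv.Perm.mul_apply, Equiv.Perm.mul_apply, A.crossPerm_val, A.crossPerm_val,
      blockMove_right (by omega) (by omega), blockMove_left (by omega) (by omega)]
    omega
  · exact h.isBlockPerm_crossPerm.max_mk ▸ absR_max (Coset.mk (subsetOf d) _ _) j hj

lemma mem_insert_subsetOf (A : AdjacentBlocks c i P a b) (hs : (s : ℕ) + 1 = P + a)
    {k : Fin (n - 1)} :
    k ∈ insert s (subsetOf c) ↔ ∀ m ≠ i + 1, c.sizeUpTo m ≠ k + 1 := by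
  rw [Finset.mem_insert, mem_subsetOf]
  constructor
  · rintro (rfl | hk) m hm
    · have ha := A.left_pos
      have hb := A.right_pos
      rcases Nat.lt_or_gt_of_ne hm with hlt | hgt
      · have hle := c.monotone_sizeUpTo (Nat.le_of_lt_succ hlt)
        rw [A.sizeUpTo_left] at hle
        omega
      · have hle := c.monotone_sizeUpTo (Nat.succ_le_of_lt hgt)
        rw [A.sizeUpTo_right] at hle
        omega
    · exact hk m
  · intro hk
    by_contra! hne
    obtain ⟨hks, m, hm⟩ := hne
    by_cases hmi : m = i + 1
    · subst hmi
      exact hks (Fin.ext (by have := A.sizeUpTo_mid; omega))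
    · exact hk m hmi hm

lemma insert_subsetOf (A : AdjacentBlocks c i P a b) (h : IsCrossing i c d)
    (hs : (s : ℕ) + 1 = P + a) (ht : (t : ℕ) + 1 = P + b) :
    insert s (subsetOf c) = insert t (subsetOf d) := by
  ext k
  rw [A.mem_insert_subsetOf hs, (A.cross h).mem_insert_subsetOf ht]
  exact forall₂_congr fun m hm => by rw [h.sizeUpTo_of_ne hm]

lemma mk_longest_insert (A : AdjacentBlocks c i P a b) (h : IsCrossing i c d)
    (hs : (s : ℕ) + 1 = P + a) (I : Finset (Fin (n - 1))) :
    Coset.mk I (subsetOf c) (longest (insert s (subsetOf c))) =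
      Coset.mk I (subsetOf c) (crossPerm c i) := by
  rw [A.longest_insert h hs, Coset.mk_mul_longest]

lemma simple_eq_longest_conj (A : AdjacentBlocks c i P a b) (h : IsCrossing i c d)
    (hs : (s : ℕ) + 1 = P + a) (ht : (t : ℕ) + 1 = P + b) :
    simple t = longest (insert s (subsetOf c)) * simple s * longest (insert s (subsetOf c)) := by
  have hsc := A.notMem_subsetOf hs
  obtain ⟨t', ht', hconj⟩ := exists_simple_eq_longest_conj (Finset.mem_insert_self s (subsetOf c))
  rw [A.insert_subsetOf h hs ht] at ht'
  obtain rfl | htd := Finset.mem_insert.1 ht'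
  · exact hconj
  obtain ⟨j, hj, hcomm⟩ := h.isBlockPerm_crossPerm.exists_mul_simple htd
  have hmem : simple s ∈ parabolic (subsetOf c) := by
    have hsimple : simple s = longest (subsetOf c) * simple j * longest (subsetOf c) := by
      have hinv := longest_inv (insert s (subsetOf c))
      rw [A.longest_insert h hs] at hinv hconj
      nth_rewrite 2 [← hinv] at hconj
      rw [mul_inv_rev, longest_inv] at hconj
      simp only [hconj, mul_assoc, inv_mul_cancel, mul_one, mul_right_inj] at hcomm
      simp only [hcomm, mul_assoc, longest_mul_longest, longest_mul_longest_mul, mul_one]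
    rw [hsimple]
    exact Subgroup.mul_mem _ (Subgroup.mul_mem _ (longest_mem _) (simple_mem hj)) (longest_mem _)
  have hle := (parabolic_le hmem hsc (lo s)).2 le_rfl
  rw [simple_lo] at hle
  exact absurd (lo_lt_hi s) hle.not_gt

lemma subsetOf_eq_erase (A : AdjacentBlocks c i P a b) (h : IsCrossing i c d)
    (hs : (s : ℕ) + 1 = P + a) (ht : (t : ℕ) + 1 = P + b) :
    subsetOf d = (insert s (subsetOf c)).erase t := by
  rw [A.insert_subsetOf h hs ht, Finset.erase_insert ((A.cross h).notMem_subsetOf ht)]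

end AdjacentBlocks

lemma IsCrossing.atomicTarget_subsetOf (h : IsCrossing i c d) (hi : i < (subsetOf c)ᶜ.card) :
    atomicTarget (subsetOf c) ⟨i, hi⟩ = subsetOf d := by
  obtain ⟨P, a, b, A⟩ := h.exists_adjacentBlocks
  obtain ⟨_, hs⟩ := A.outer_subsetOf
  obtain ⟨_, ht⟩ := (A.cross h).outer_subsetOf
  rw [A.subsetOf_eq_erase h hs ht, atomicTarget, atomicTop, ← A.simple_eq_longest_conj h hs ht,
    Finset.filter_congr (q := (· ≠ _)) (fun k _ => simple_injective.ne_iff), Finset.filter_ne']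

end

/-! ### Reduced paths of crossings -/

section

variable {n : ℕ} {c d e : Strands n} {i j : ℕ} {x : Equiv.Perm (Fin n)}

/-- The permutation of the letters performed by a path of crossings. -/
def pathPerm {c : Strands n} : ∀ {d : Strands n}, Quiver.Path c d → Equiv.Perm (Fin n)
  | _, .nil => 1
  | _, .cons (b := z) p e => crossPerm z.labels e.1 * pathPerm p

/-- A path of crossings is reduced if the lengths of its crossings add up to the length of the
permutation it performs. -/
def IsReducedPath {c : Strands n} : ∀ {d : Strands n}, Quiver.Path c d → Prop
  | _, .nil => True
  | _, .cons (b := z) p e => IsReducedPath p ∧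
      len (crossPerm z.labels e.1 * pathPerm p) = len (crossPerm z.labels e.1) + len (pathPerm p)

lemma isBlockPerm_pathPerm (p : Quiver.Path c d) :
    IsBlockPerm (subsetOf c.labels) (subsetOf d.labels) (pathPerm p) := by
  induction p with
  | nil => exact IsBlockPerm.one _
  | cons p e ih => exact e.2.isBlockPerm_crossPerm.mul ih

lemma isReducedPath_cons_iff {p : Quiver.Path c d} {h : IsCrossing i d.labels e.labels} :
    IsReducedPath (p.cons (⟨i, h⟩ : d ⟶ e)) ↔ IsReducedPath p ∧
      blockStart d.labels (pathPerm p) i < blockStart d.labels (pathPerm p) (i + 1) :=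
  and_congr_right fun _ => (isBlockPerm_pathPerm p).len_crossPerm_mul_iff h

lemma blockStart_pathPerm_cons (p : Quiver.Path c d) (h : IsCrossing i d.labels e.labels) (m : ℕ) :
    blockStart e.labels (pathPerm (p.cons (⟨i, h⟩ : d ⟶ e))) m =
      blockStart d.labels (pathPerm p) (Equiv.swap i (i + 1) m) :=
  h.blockStart_crossPerm_mul _ m

lemma IsReducedPath.blockStart_lt {p : Quiver.Path c d} {h : IsCrossing i d.labels e.labels}
    (hp : IsReducedPath (p.cons (⟨i, h⟩ : d ⟶ e))) :
    blockStart e.labels (pathPerm (p.cons (⟨i, h⟩ : d ⟶ e))) (i + 1) <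
      blockStart e.labels (pathPerm (p.cons (⟨i, h⟩ : d ⟶ e))) i := by
  rw [blockStart_pathPerm_cons, blockStart_pathPerm_cons, Equiv.swap_apply_left,
    Equiv.swap_apply_right]
  exact (isReducedPath_cons_iff.1 hp).2

lemma IsReducedPath.len_lt {p : Quiver.Path c d} {f : d ⟶ e} (hp : IsReducedPath (p.cons f)) :
    len (pathPerm p) < len (pathPerm (p.cons f)) :=
  hp.2 ▸ Nat.lt_add_of_pos_left (len_pos f.2.crossPerm_ne_one)

lemma IsReducedPath.cons_of_gt {p : Quiver.Path c e} (hp : IsReducedPath p)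
    (hx : IsBlockPerm (subsetOf c.labels) (subsetOf d.labels) x)
    (h : IsCrossing i d.labels e.labels)
    (hgt : blockStart d.labels x (i + 1) < blockStart d.labels x i)
    (hpx : pathPerm p = crossPerm d.labels i * x) :
    IsReducedPath (p.cons (⟨i, h.symm⟩ : e ⟶ d)) ∧
      pathPerm (p.cons (⟨i, h.symm⟩ : e ⟶ d)) = x := by
  have hperm : crossPerm e.labels i * pathPerm p = x := by rw [hpx, h.crossPerm_mul_crossPerm]
  refine ⟨⟨hp, ?_⟩, hperm⟩
  rw [hperm, hpx]
  exact hx.len_eq_of_gt h hgt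

theorem exists_isReducedPath (hx : IsBlockPerm (subsetOf c.labels) (subsetOf d.labels) x) :
    ∃ p : Quiver.Path c d, IsReducedPath p ∧ pathPerm p = x := by
  induction hk : len x using Nat.strong_induction_on generalizing d x with
  | _ k ih =>
    by_cases hne : x = 1
    · subst hne
      obtain rfl : c = d := congrArg Strands.mk (subsetOf_injective hx.eq_of_one)
      exact ⟨.nil, trivial, rfl⟩
    obtain ⟨i, z, h, hgt⟩ := hx.exists_isCrossing_gt hne
    have hlen := hx.len_eq_of_gt h hgt
    have hpos := len_pos h.symm.crossPerm_ne_one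
    obtain ⟨p, hp, hpx⟩ := ih _ (by omega) (d := ⟨z⟩) (h.isBlockPerm_crossPerm.mul hx) rfl
    exact ⟨_, hp.cons_of_gt hx h hgt hpx⟩

lemma swap_apply_add_two (i : ℕ) : Equiv.swap i (i + 1) (i + 1 + 1) = i + 1 + 1 :=
  Equiv.swap_apply_of_ne_of_ne (by omega) (by omega)

lemma swap_succ_apply (i : ℕ) : Equiv.swap (i + 1) (i + 1 + 1) i = i :=
  Equiv.swap_apply_of_ne_of_ne (by omega) (by omega)

section ShortPaths

variable {c₁ c₂ d₁ d₂ : Strands n}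

lemma pathPerm_braid (p : Quiver.Path c d) (h₁ : IsCrossing i d.labels c₁.labels)
    (h₂ : IsCrossing (i + 1) c₁.labels c₂.labels) (h₃ : IsCrossing i c₂.labels e.labels)
    (k₁ : IsCrossing (i + 1) d.labels d₁.labels) (k₂ : IsCrossing i d₁.labels d₂.labels)
    (k₃ : IsCrossing (i + 1) d₂.labels e.labels) :
    pathPerm (((p.cons (⟨i, h₁⟩ : d ⟶ c₁)).cons (⟨i + 1, h₂⟩ : c₁ ⟶ c₂)).cons
        (⟨i, h₃⟩ : c₂ ⟶ e)) =
      pathPerm (((p.cons (⟨i + 1, k₁⟩ : d ⟶ d₁)).cons (⟨i, k₂⟩ : d₁ ⟶ d₂)).cons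
        (⟨i + 1, k₃⟩ : d₂ ⟶ e)) := by
  have := congrArg (· * pathPerm p) (crossPerm_braid h₁ h₂ k₁ k₂)
  simpa only [pathPerm, mul_assoc] using this

lemma pathPerm_comm (hij : i + 1 < j ∨ j + 1 < i) (p : Quiver.Path c d)
    (h₁ : IsCrossing j d.labels c₁.labels) (h₂ : IsCrossing i c₁.labels e.labels)
    (k₁ : IsCrossing i d.labels d₁.labels) (k₂ : IsCrossing j d₁.labels e.labels) :
    pathPerm ((p.cons (⟨j, h₁⟩ : d ⟶ c₁)).cons (⟨i, h₂⟩ : c₁ ⟶ e)) =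
      pathPerm ((p.cons (⟨i, k₁⟩ : d ⟶ d₁)).cons (⟨j, k₂⟩ : d₁ ⟶ e)) := by
  have := congrArg (· * pathPerm p) (crossPerm_comm hij h₁ k₁)
  simpa only [pathPerm, mul_assoc] using this

lemma IsReducedPath.braid_left {p : Quiver.Path c d} (hp : IsReducedPath p)
    (hlt : blockStart d.labels (pathPerm p) i < blockStart d.labels (pathPerm p) (i + 1))
    (hlt' : blockStart d.labels (pathPerm p) (i + 1) < blockStart d.labels (pathPerm p) (i + 2))
    (h₁ : IsCrossing i d.labels c₁.labels)
    (h₂ : IsCrossing (i + 1) c₁.labels c₂.labels) (h₃ : IsCrossing i c₂.labels e.labels) :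
    IsReducedPath (((p.cons (⟨i, h₁⟩ : d ⟶ c₁)).cons (⟨i + 1, h₂⟩ : c₁ ⟶ c₂)).cons
        (⟨i, h₃⟩ : c₂ ⟶ e)) := by
  simp only [isReducedPath_cons_iff, blockStart_pathPerm_cons, Equiv.swap_apply_left,
    Equiv.swap_apply_right, swap_apply_add_two, swap_succ_apply]
  exact ⟨⟨⟨hp, hlt⟩, hlt.trans hlt'⟩, hlt'⟩

lemma IsReducedPath.braid_right {p : Quiver.Path c d} (hp : IsReducedPath p)
    (hlt : blockStart d.labels (pathPerm p) i < blockStart d.labels (pathPerm p) (i + 1))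
    (hlt' : blockStart d.labels (pathPerm p) (i + 1) < blockStart d.labels (pathPerm p) (i + 2))
    (h₁ : IsCrossing (i + 1) d.labels c₁.labels)
    (h₂ : IsCrossing i c₁.labels c₂.labels) (h₃ : IsCrossing (i + 1) c₂.labels e.labels) :
    IsReducedPath (((p.cons (⟨i + 1, h₁⟩ : d ⟶ c₁)).cons (⟨i, h₂⟩ : c₁ ⟶ c₂)).cons
        (⟨i + 1, h₃⟩ : c₂ ⟶ e)) := by
  simp only [isReducedPath_cons_iff, blockStart_pathPerm_cons, Equiv.swap_apply_left,
    Equiv.swap_apply_right, swap_apply_add_two, swap_succ_apply]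
  exact ⟨⟨⟨hp, hlt'⟩, hlt.trans hlt'⟩, hlt⟩

lemma IsReducedPath.comm {p : Quiver.Path c d} (hp : IsReducedPath p)
    (hij : i + 1 < j ∨ j + 1 < i)
    (hi : blockStart d.labels (pathPerm p) i < blockStart d.labels (pathPerm p) (i + 1))
    (hj : blockStart d.labels (pathPerm p) j < blockStart d.labels (pathPerm p) (j + 1))
    (h₁ : IsCrossing j d.labels c₁.labels) (h₂ : IsCrossing i c₁.labels e.labels) :
    IsReducedPath ((p.cons (⟨j, h₁⟩ : d ⟶ c₁)).cons (⟨i, h₂⟩ : c₁ ⟶ e)) := by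
  rw [isReducedPath_cons_iff, isReducedPath_cons_iff, blockStart_pathPerm_cons,
    blockStart_pathPerm_cons, Equiv.swap_apply_of_ne_of_ne (by omega) (by omega),
    Equiv.swap_apply_of_ne_of_ne (by omega) (by omega)]
  exact ⟨⟨hp, hj⟩, hi⟩

lemma not_isReducedPath_nil (p : Quiver.Path c d) (h₁ : IsCrossing i d.labels c₁.labels)
    (h₂ : IsCrossing i c₁.labels e.labels) :
    ¬ IsReducedPath ((p.cons (⟨i, h₁⟩ : d ⟶ c₁)).cons (⟨i, h₂⟩ : c₁ ⟶ e)) := fun h => by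
  obtain ⟨hp, hlt⟩ := isReducedPath_cons_iff.1 h
  exact hlt.not_gt hp.blockStart_lt

end ShortPaths

end

/-! ### The word property -/

section

variable {R : Type u} [CommRing R] {n : ℕ} {c d e c₁ c₂ d₁ d₂ : Strands n} {i j : ℕ}
  {x : Equiv.Perm (Fin n)}

variable (R) in
/-- The morphism of `NC(n)` represented by a path of crossings. -/
abbrev NC.ofPath (p : Quiver.Path c d) : (⟨c⟩ : NC R n) ⟶ ⟨d⟩ := Presented.ofPath p

namespace NC

lemma ofPath_cons_congr {p q : Quiver.Path c d} (h : ofPath R p = ofPath R q) (f : d ⟶ e) :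
    ofPath R (p.cons f) = ofPath R (q.cons f) :=
  (Presented.ofPath_cons ..).trans ((congrArg (· ≫ _) h).trans (Presented.ofPath_cons ..).symm)

lemma ofPath_comp_congr (p : Quiver.Path c d) {q r : Quiver.Path d e}
    (h : ofPath R q = ofPath R r) : ofPath R (p.comp q) = ofPath R (p.comp r) :=
  (Presented.ofPath_comp ..).trans ((congrArg (_ ≫ ·) h).trans (Presented.ofPath_comp ..).symm)

lemma ofPath_braid (p : Quiver.Path c d) (h₁ : IsCrossing i d.labels c₁.labels)
    (h₂ : IsCrossing (i + 1) c₁.labels c₂.labels) (h₃ : IsCrossing i c₂.labels e.labels)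
    (k₁ : IsCrossing (i + 1) d.labels d₁.labels) (k₂ : IsCrossing i d₁.labels d₂.labels)
    (k₃ : IsCrossing (i + 1) d₂.labels e.labels) :
    ofPath R (((p.cons (⟨i, h₁⟩ : d ⟶ c₁)).cons (⟨i + 1, h₂⟩ : c₁ ⟶ c₂)).cons
        (⟨i, h₃⟩ : c₂ ⟶ e)) =
      ofPath R (((p.cons (⟨i + 1, k₁⟩ : d ⟶ d₁)).cons (⟨i, k₂⟩ : d₁ ⟶ d₂)).cons
        (⟨i + 1, k₃⟩ : d₂ ⟶ e)) :=
  ofPath_comp_congr p (Presented.ofPath_eq_of_sub_mem_rel (NilRelator.braid i h₁ h₂ h₃ k₁ k₂ k₃))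

lemma ofPath_comm (hij : i + 1 < j ∨ j + 1 < i) (p : Quiver.Path c d)
    (h₁ : IsCrossing j d.labels c₁.labels) (h₂ : IsCrossing i c₁.labels e.labels)
    (k₁ : IsCrossing i d.labels d₁.labels) (k₂ : IsCrossing j d₁.labels e.labels) :
    ofPath R ((p.cons (⟨j, h₁⟩ : d ⟶ c₁)).cons (⟨i, h₂⟩ : c₁ ⟶ e)) =
      ofPath R ((p.cons (⟨i, k₁⟩ : d ⟶ d₁)).cons (⟨j, k₂⟩ : d₁ ⟶ e)) :=
  ofPath_comp_congr p (Presented.ofPath_eq_of_sub_mem_rel (NilRelator.comm i j hij h₁ h₂ k₁ k₂))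

lemma ofPath_nil_relation (p : Quiver.Path c d) (h₁ : IsCrossing i d.labels c₁.labels)
    (h₂ : IsCrossing i c₁.labels e.labels) :
    ofPath R ((p.cons (⟨i, h₁⟩ : d ⟶ c₁)).cons (⟨i, h₂⟩ : c₁ ⟶ e)) = 0 := by
  refine (Presented.ofPath_comp p ((crossing i h₁).comp (crossing i h₂))).trans ?_
  have hnil : ofPath R ((crossing i h₁).comp (crossing i h₂)) = 0 :=
    Presented.toHom_eq_zero_of_mem_rel (NilRelator.nil i h₁ h₂)
  exact (congrArg (_ ≫ ·) hnil).trans Limits.comp_zero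

end NC

variable (R) in
/-- The diamond property for two crossings into `d`: the permutation `x` is performed by reduced
paths from `c` ending in either crossing, and these paths agree in `NC(n)`. -/
def HasDiamond (c : Strands n) (x : Equiv.Perm (Fin n)) (f : d₁ ⟶ d) (g : d₂ ⟶ d) : Prop :=
  ∃ (p : Quiver.Path c d₁) (q : Quiver.Path c d₂),
    IsReducedPath (p.cons f) ∧ IsReducedPath (q.cons g) ∧
    pathPerm (p.cons f) = x ∧ pathPerm (q.cons g) = x ∧
    NC.ofPath R (p.cons f) = NC.ofPath R (q.cons g)

namespace HasDiamond

lemma symm {f : d₁ ⟶ d} {g : d₂ ⟶ d} : HasDiamond R c x f g → HasDiamond R c x g f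
  | ⟨p, q, hp, hq, hpx, hqx, h⟩ => ⟨q, p, hq, hp, hqx, hpx, h.symm⟩

lemma of_far (hx : IsBlockPerm (subsetOf c.labels) (subsetOf d.labels) x)
    (h : IsCrossing i d₁.labels d.labels) (k : IsCrossing j d₂.labels d.labels)
    (hij : i + 1 < j ∨ j + 1 < i)
    (hi : blockStart d.labels x (i + 1) < blockStart d.labels x i)
    (hj : blockStart d.labels x (j + 1) < blockStart d.labels x j) :
    HasDiamond R c x (⟨i, h⟩ : d₁ ⟶ d) (⟨j, k⟩ : d₂ ⟶ d) := by
  obtain ⟨z, h', k'⟩ := h.exists_square k hij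
  obtain ⟨s, hs, hsx⟩ := exists_isReducedPath (c := c) (d := ⟨z⟩)
    (h'.symm.isBlockPerm_crossPerm.mul (h.symm.isBlockPerm_crossPerm.mul hx))
  have starts (m) : blockStart z (pathPerm s) m =
      blockStart d.labels x (Equiv.swap i (i + 1) (Equiv.swap j (j + 1) m)) := by
    rw [hsx, h'.symm.blockStart_crossPerm_mul, h.symm.blockStart_crossPerm_mul]
  have hsi : blockStart z (pathPerm s) i < blockStart z (pathPerm s) (i + 1) := by
    rwa [starts, starts, Equiv.swap_apply_of_ne_of_ne (a := j) (x := i) (by omega) (by omega),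
      Equiv.swap_apply_of_ne_of_ne (a := j) (x := i + 1) (by omega) (by omega),
      Equiv.swap_apply_left, Equiv.swap_apply_right]
  have hsj : blockStart z (pathPerm s) j < blockStart z (pathPerm s) (j + 1) := by
    rwa [starts, starts, Equiv.swap_apply_left, Equiv.swap_apply_right,
      Equiv.swap_apply_of_ne_of_ne (a := i) (x := j) (by omega) (by omega),
      Equiv.swap_apply_of_ne_of_ne (a := i) (x := j + 1) (by omega) (by omega)]
  have hperm : pathPerm ((s.cons (⟨j, h'⟩ : (⟨z⟩ : Strands n) ⟶ d₁)).cons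
      (⟨i, h⟩ : d₁ ⟶ d)) = x := by
    rw [pathPerm, pathPerm, hsx, h'.symm.crossPerm_mul_crossPerm, h.symm.crossPerm_mul_crossPerm]
  exact ⟨_, _, hs.comm hij hsi hsj h' h, hs.comm hij.symm hsj hsi k' k, hperm,
    (pathPerm_comm hij s h' h k' k).symm.trans hperm, NC.ofPath_comm hij s h' h k' k⟩

lemma of_succ (hx : IsBlockPerm (subsetOf c.labels) (subsetOf d.labels) x)
    (h : IsCrossing i d₁.labels d.labels) (k : IsCrossing (i + 1) d₂.labels d.labels)
    (hi : blockStart d.labels x (i + 1) < blockStart d.labels x i)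
    (hj : blockStart d.labels x (i + 2) < blockStart d.labels x (i + 1)) :
    HasDiamond R c x (⟨i, h⟩ : d₁ ⟶ d) (⟨i + 1, k⟩ : d₂ ⟶ d) := by
  obtain ⟨c₁, c₂, z, h₁, h₂, k₁, k₂⟩ := h.exists_hexagon k
  obtain ⟨s, hs, hsx⟩ := exists_isReducedPath (c := c) (d := ⟨z⟩)
    (h₁.symm.isBlockPerm_crossPerm.mul (h₂.symm.isBlockPerm_crossPerm.mul
      (h.symm.isBlockPerm_crossPerm.mul hx)))
  have starts (m) : blockStart z (pathPerm s) m = blockStart d.labels x (Equiv.swap i (i + 1)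
      (Equiv.swap (i + 1) (i + 1 + 1) (Equiv.swap i (i + 1) m))) := by
    rw [hsx, h₁.symm.blockStart_crossPerm_mul, h₂.symm.blockStart_crossPerm_mul,
      h.symm.blockStart_crossPerm_mul]
  have hlt : blockStart z (pathPerm s) i < blockStart z (pathPerm s) (i + 1) := by
    simpa only [starts, Equiv.swap_apply_left, Equiv.swap_apply_right, swap_apply_add_two,
      swap_succ_apply] using hj
  have hlt' : blockStart z (pathPerm s) (i + 1) < blockStart z (pathPerm s) (i + 2) := by
    simpa only [starts, Equiv.swap_apply_left, Equiv.swap_apply_right, swap_apply_add_two,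
      swap_succ_apply] using hi
  have hperm : pathPerm (((s.cons (⟨i, h₁⟩ : (⟨z⟩ : Strands n) ⟶ ⟨c₁⟩)).cons
      (⟨i + 1, h₂⟩ : ⟨c₁⟩ ⟶ d₁)).cons (⟨i, h⟩ : d₁ ⟶ d)) = x := by
    rw [pathPerm, pathPerm, pathPerm, hsx, h₁.symm.crossPerm_mul_crossPerm,
      h₂.symm.crossPerm_mul_crossPerm, h.symm.crossPerm_mul_crossPerm]
  have hbraid := pathPerm_braid (c₁ := ⟨c₁⟩) (d₁ := ⟨c₂⟩) s h₁ h₂ h k₁ k₂ k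
  exact ⟨_, _, hs.braid_left (c₁ := ⟨c₁⟩) hlt hlt' h₁ h₂ h,
    hs.braid_right (c₁ := ⟨c₂⟩) hlt hlt' k₁ k₂ k, hperm, hbraid.symm.trans hperm,
    NC.ofPath_braid (c₁ := ⟨c₁⟩) (d₁ := ⟨c₂⟩) s h₁ h₂ h k₁ k₂ k⟩

lemma of_isReducedPath {p : Quiver.Path c d₁} {q : Quiver.Path c d₂} {f : d₁ ⟶ d} {g : d₂ ⟶ d}
    (hp : IsReducedPath (p.cons f)) (hq : IsReducedPath (q.cons g))
    (h : pathPerm (p.cons f) = pathPerm (q.cons g)) :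
    HasDiamond R c (pathPerm (p.cons f)) f g := by
  have hx := isBlockPerm_pathPerm (p.cons f)
  obtain ⟨i, hi⟩ := f
  obtain ⟨j, hj⟩ := g
  have hf := hp.blockStart_lt
  have hg := hq.blockStart_lt
  rw [← h] at hg
  rcases lt_trichotomy i j with hij | rfl | hij
  · rcases (Nat.succ_le_of_lt hij).lt_or_eq with hij | rfl
    · exact of_far hx hi hj (.inl hij) hf hg
    · exact of_succ hx hi hj hf hg
  · obtain rfl : d₁ = d₂ := congrArg Strands.mk (hi.symm.target_unique hj.symm)
    exact ⟨p, p, hp, hp, rfl, rfl, rfl⟩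
  · rcases (Nat.succ_le_of_lt hij).lt_or_eq with hij | rfl
    · exact of_far hx hi hj (.inr hij) hf hg
    · exact (of_succ hx hj hi hg hf).symm

end HasDiamond

theorem IsReducedPath.ofPath_eq {p q : Quiver.Path c d} (hp : IsReducedPath p)
    (hq : IsReducedPath q) (h : pathPerm p = pathPerm q) : NC.ofPath R p = NC.ofPath R q := by
  induction hk : len (pathPerm p) using Nat.strong_induction_on generalizing d with
  | _ k ih =>
    have cons_eq {z : Strands n} {f : z ⟶ d} {r s : Quiver.Path c z}
        (hr : IsReducedPath (r.cons f)) (hs : IsReducedPath (s.cons f))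
        (hrs : pathPerm (r.cons f) = pathPerm (s.cons f)) (hrp : pathPerm (r.cons f) = pathPerm p) :
        NC.ofPath R (r.cons f) = NC.ofPath R (s.cons f) :=
      NC.ofPath_cons_congr (ih _ (hk ▸ hrp ▸ hr.len_lt) hr.1 hs.1 (mul_left_cancel hrs) rfl) f
    cases p with
    | nil =>
      cases q with
      | nil => rfl
      | cons q g => exact absurd (h ▸ hq.len_lt) (by simp [pathPerm, len_one])
    | cons p f =>
      cases q with
      | nil => exact absurd (h ▸ hp.len_lt) (by simp [pathPerm, len_one])
      | cons q g =>
        obtain ⟨r, s, hr, hs, hrx, hsx, hrs⟩ := HasDiamond.of_isReducedPath (R := R) hp hq h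
        exact (cons_eq hp hr hrx.symm rfl).trans (hrs.trans
          (cons_eq hs hq (hsx.trans h) hsx))

theorem NC.ofPath_eq_zero {p : Quiver.Path c d} (hp : ¬ IsReducedPath p) :
    NC.ofPath R p = 0 := by
  induction p with
  | nil => exact absurd trivial hp
  | @cons d e p f ih =>
    by_cases hp' : IsReducedPath p
    · obtain ⟨i, h⟩ := f
      obtain ⟨P, a, b, A⟩ := h.exists_adjacentBlocks
      have hx := isBlockPerm_pathPerm p
      have hgt : blockStart d.labels (pathPerm p) (i + 1) < blockStart d.labels (pathPerm p) i :=
        (blockStart_ne A.succ_lt_length _).lt_or_gt.resolve_left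
          fun hlt => hp (isReducedPath_cons_iff.2 ⟨hp', hlt⟩)
      obtain ⟨q, hq, hqx⟩ := exists_isReducedPath (h.isBlockPerm_crossPerm.mul hx)
      obtain ⟨hqr, hqp⟩ := hq.cons_of_gt hx h hgt hqx
      exact (NC.ofPath_cons_congr (hp'.ofPath_eq hqr hqp.symm) _).trans
        (NC.ofPath_nil_relation q h.symm h)
    · have hzero : ofPath R (p.cons f) = 0 ≫ Presented.gen f :=
        (Presented.ofPath_cons ..).trans (congrArg (· ≫ _) (ih hp'))
      exact hzero.trans Limits.zero_comp

end

/-! ### The isomorphism -/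

section

variable {R : Type u} [CommRing R] {n : ℕ} {c d : Strands n} {i : ℕ}
  {I J K : Finset (Fin (n - 1))} {x y : Equiv.Perm (Fin n)}

namespace NilCoxeter

lemma del_mk_comp (hy : IsBlockPerm K J y) (hx : IsBlockPerm J I x)
    (h : len (x * y) = len x + len y) :
    del R (Coset.mk J K y) ≫ del R (Coset.mk I J x) = del R (Coset.mk I K (x * y)) := by
  rw [← hx.star_mk hy h]
  exact (nilComp_single _ _).trans (if_pos ((hx.isReduced_iff hy).2 h))

lemma del_mk_comp_eq_zero (hy : IsBlockPerm K J y) (hx : IsBlockPerm J I x)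
    (h : len (x * y) ≠ len x + len y) :
    del R (Coset.mk J K y) ≫ del R (Coset.mk I J x) = 0 :=
  (nilComp_single _ _).trans (if_neg fun hred => h ((hx.isReduced_iff hy).1 hred))

end NilCoxeter

variable (R n) in
/-- The quiver morphism to the nilCoxeter algebroid that sends a crossing to `∂_p`, where `p` is
the coset of the permutation exchanging the two adjacent blocks. -/
def crossingDel : Strands n ⥤q NilCoxeter R n where
  obj c := ⟨subsetOf c.labels⟩
  map {c _} f := NilCoxeter.del R (Coset.mk _ _ (crossPerm c.labels f.1))

lemma composePath_crossingDel {p : Quiver.Path c d} (hp : IsReducedPath p) :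
    composePath ((crossingDel R n).mapPath p) = NilCoxeter.del R (Coset.mk _ _ (pathPerm p)) := by
  induction p with
  | nil => rfl
  | cons p f ih =>
    rw [Prefunctor.mapPath_cons, composePath_cons, ih hp.1]
    exact NilCoxeter.del_mk_comp (isBlockPerm_pathPerm p) f.2.isBlockPerm_crossPerm hp.2

lemma composePath_crossingDel_eq_zero {p : Quiver.Path c d} (hp : ¬ IsReducedPath p) :
    composePath ((crossingDel R n).mapPath p) = 0 := by
  induction p with
  | nil => exact absurd trivial hp
  | cons p f ih =>
    rw [Prefunctor.mapPath_cons, composePath_cons]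
    by_cases hp' : IsReducedPath p
    · rw [composePath_crossingDel hp']
      exact NilCoxeter.del_mk_comp_eq_zero (isBlockPerm_pathPerm p) f.2.isBlockPerm_crossPerm
        fun hlen => hp ⟨hp', hlen⟩
    · rw [ih hp', Limits.zero_comp]

lemma evalPaths_crossingDel_sub {p q : Quiver.Path c d} (hp : IsReducedPath p)
    (hq : IsReducedPath q) (h : pathPerm p = pathPerm q) :
    Presented.evalPaths R (crossingDel R n) c d (Finsupp.single p 1 - Finsupp.single q 1) = 0 := by
  rw [map_sub, Presented.evalPaths_single, Presented.evalPaths_single, composePath_crossingDel hp,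
    composePath_crossingDel hq, h, sub_self]

lemma evalPaths_crossingDel_relator {y : Quiver.Path c d →₀ R} (h : NilRelator R n c d y) :
    Presented.evalPaths R (crossingDel R n) c d y = 0 := by
  have start_lt {c c₁ : Strands n} {i : ℕ} (h : IsCrossing i c.labels c₁.labels) :
      blockStart c.labels 1 i < blockStart c.labels 1 (i + 1) := by
    obtain ⟨P, a, b, A⟩ := h.exists_adjacentBlocks
    exact blockStart_one_lt A.succ_lt_length
  have hnil : IsReducedPath (Quiver.Path.nil : Quiver.Path c c) := trivial
  cases h with
  | braid i h₁ h₂ h₃ k₁ k₂ k₃ =>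
    exact evalPaths_crossingDel_sub (hnil.braid_left (start_lt h₁) (start_lt k₁) h₁ h₂ h₃)
      (hnil.braid_right (start_lt h₁) (start_lt k₁) k₁ k₂ k₃) (pathPerm_braid _ h₁ h₂ h₃ k₁ k₂ k₃)
  | comm i j hij h₁ h₂ k₁ k₂ =>
    exact evalPaths_crossingDel_sub (hnil.comm hij (start_lt k₁) (start_lt h₁) h₁ h₂)
      (hnil.comm hij.symm (start_lt h₁) (start_lt k₁) k₁ k₂) (pathPerm_comm hij _ h₁ h₂ k₁ k₂)
  | nil i h₁ h₂ =>
    rw [Presented.evalPaths_single, one_smul]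
    exact composePath_crossingDel_eq_zero (not_isReducedPath_nil _ h₁ h₂)

variable (R n) in
/-- The linear functor from `NC(n)` to the nilCoxeter algebroid sending a crossing to the `∂_p` of
its coset. -/
def toNilCoxeter : NC R n ⥤ NilCoxeter R n :=
  Presented.lift (φ := crossingDel R n) fun _ _ _ => evalPaths_crossingDel_relator

instance : (toNilCoxeter R n).Additive := inferInstanceAs (Presented.lift _).Additive

instance : (toNilCoxeter R n).Linear R := inferInstanceAs ((Presented.lift _).Linear R)

lemma toNilCoxeter_map_ofPath (p : Quiver.Path c d) :
    (toNilCoxeter R n).map (NC.ofPath R p) = composePath ((crossingDel R n).mapPath p) :=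
  Presented.lift_map_ofPath _ p

lemma toNilCoxeter_map_gen (h : IsCrossing i c.labels d.labels) :
    (toNilCoxeter R n).map (Presented.gen (X := ⟨c⟩) (Y := ⟨d⟩) (⟨i, h⟩ : c ⟶ d)) =
      NilCoxeter.del R (Coset.mk _ _ (crossPerm c.labels i)) :=
  (toNilCoxeter_map_ofPath _).trans (Category.id_comp _)

open Classical in
variable (R) in
/-- The class in `NC(n)` of the reduced paths performing a permutation in the given coset, and `0`
if there are none. -/
def classOfCoset (q : Coset (subsetOf d.labels) (subsetOf c.labels)) : (⟨c⟩ : NC R n) ⟶ ⟨d⟩ :=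
  if h : ∃ p : Quiver.Path c d, IsReducedPath p ∧ Coset.mk _ _ (pathPerm p) = q then
    NC.ofPath R h.choose else 0

lemma classOfCoset_mk {p : Quiver.Path c d} (hp : IsReducedPath p) :
    classOfCoset R (Coset.mk _ _ (pathPerm p)) = NC.ofPath R p := by
  have h : ∃ q : Quiver.Path c d, IsReducedPath q ∧
      Coset.mk (subsetOf d.labels) (subsetOf c.labels) (pathPerm q) = Coset.mk _ _ (pathPerm p) :=
    ⟨p, hp, rfl⟩
  rw [classOfCoset, dif_pos h]
  exact h.choose_spec.1.ofPath_eq hp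
    ((isBlockPerm_pathPerm _).eq_of_mk_eq (isBlockPerm_pathPerm p) h.choose_spec.2)

variable (R c d) in
/-- The linear extension of `classOfCoset`, a left inverse of `toNilCoxeter` on morphisms. -/
def classOfHom : ((toNilCoxeter R n).obj ⟨c⟩ ⟶ (toNilCoxeter R n).obj ⟨d⟩) →ₗ[R]
    ((⟨c⟩ : NC R n) ⟶ ⟨d⟩) :=
  Finsupp.linearCombination R (classOfCoset R)

lemma classOfHom_map_ofPath (p : Quiver.Path c d) :
    classOfHom R c d ((toNilCoxeter R n).map (NC.ofPath R p)) = NC.ofPath R p := by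
  rw [toNilCoxeter_map_ofPath]
  by_cases hp : IsReducedPath p
  · rw [composePath_crossingDel hp, ← classOfCoset_mk hp]
    exact (Finsupp.linearCombination_single R 1 _).trans (one_smul R _)
  · rw [composePath_crossingDel_eq_zero hp, NC.ofPath_eq_zero hp]
    exact map_zero _

lemma classOfHom_map (f : (⟨c⟩ : NC R n) ⟶ ⟨d⟩) :
    classOfHom R c d ((toNilCoxeter R n).map f) = f := by
  induction f using Presented.hom_induction with
  | zero => rw [Functor.map_zero, map_zero]
  | add f g hf hg => rw [Functor.map_add, map_add, hf, hg]
  | smul_ofPath r p =>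
    rw [Functor.map_smul, map_smul]
    exact congrArg (r • ·) (classOfHom_map_ofPath p)

instance : (toNilCoxeter R n).Faithful where
  map_injective h := Function.LeftInverse.injective classOfHom_map h

lemma toNilCoxeter_obj_bijective : Function.Bijective (toNilCoxeter R n).obj := by
  constructor
  · rintro ⟨⟨c⟩⟩ ⟨⟨d⟩⟩ h
    exact congrArg (NC.of R) (subsetOf_injective (congrArg NilCoxeter.subset h))
  · rintro ⟨J⟩
    obtain ⟨c, rfl⟩ := subsetOf_bijective.2 J
    exact ⟨NC.of R c, rfl⟩

lemma IsCrossing.isAtomic {c d : Composition n} (h : IsCrossing i c d) :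
    (Coset.mk (subsetOf d) (subsetOf c) (crossPerm c i)).IsAtomic := by
  obtain ⟨P, a, b, A⟩ := h.exists_adjacentBlocks
  obtain ⟨_, hs⟩ := A.outer_subsetOf
  obtain ⟨_, ht⟩ := (A.cross h).outer_subsetOf
  refine ⟨_, _, _, ?_, Finset.mem_insert_self _ _, ?_, A.subsetOf_eq_erase h hs ht,
    (Finset.erase_insert (A.notMem_subsetOf hs)).symm, (A.mk_longest_insert h hs _).symm⟩
  · rw [A.insert_subsetOf h hs ht]
    exact Finset.mem_insert_self _ _
  · rw [A.insert_subsetOf h hs ht]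
    exact (A.cross h).simple_eq_longest_conj h.symm ht hs

lemma Coset.IsAtomic.exists_isCrossing {c d : Composition n}
    {p : Coset (subsetOf d) (subsetOf c)} (hp : p.IsAtomic) :
    ∃ i, IsCrossing i c d ∧ Coset.mk _ _ (crossPerm c i) = p := by
  obtain ⟨M, s, t, hs, ht, hst, hI, hJ, rfl⟩ := hp
  have hM : insert t (subsetOf c) = M := by rw [hJ, Finset.insert_erase ht]
  obtain ⟨i, P, a, b, A, hta⟩ := exists_adjacentBlocks_of_notMem (c := c) (s := t)
    (hJ ▸ Finset.notMem_erase t M)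
  obtain ⟨d', h⟩ := A.exists_isCrossing
  obtain ⟨_, hs'⟩ := (A.cross h).outer_subsetOf
  obtain rfl : s = outer (subsetOf d') _ := simple_injective <| by
    rw [A.simple_eq_longest_conj h hta hs', hM]
    simp only [hst, mul_assoc, longest_mul_longest, longest_mul_longest_mul, mul_one]
  obtain rfl : d = d' := subsetOf_injective <|
    hI.trans (hM ▸ A.subsetOf_eq_erase h hta hs').symm
  exact ⟨i, h, by rw [← hM, A.mk_longest_insert h hta]⟩

lemma mem_atomicMorphisms_of_crossing (h : IsCrossing i c.labels d.labels) :
    atomicMorphisms R n ((toNilCoxeter R n).map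
      (Presented.gen (X := ⟨c⟩) (Y := ⟨d⟩) (⟨i, h⟩ : c ⟶ d))) :=
  ⟨_, h.isAtomic, toNilCoxeter_map_gen h⟩

lemma toNilCoxeter_map_mem {X Y : NC R n} (f : X ⟶ Y) :
    GeneratedSubcategory.Mem R (atomicMorphisms R n) ((toNilCoxeter R n).map f) :=
  Presented.mem_of_mem_gen (toNilCoxeter R n)
    (fun {_ _} ⟨_, h⟩ => .of _ (mem_atomicMorphisms_of_crossing h)) f

lemma exists_map_eq_of_mem_atomicMorphisms {X Y : NC R n}
    {f : (toNilCoxeter R n).obj X ⟶ (toNilCoxeter R n).obj Y} (hf : atomicMorphisms R n f) :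
    ∃ g : X ⟶ Y, (toNilCoxeter R n).map g = f := by
  obtain ⟨p, hp, rfl⟩ := hf
  obtain ⟨i, h, rfl⟩ := Coset.IsAtomic.exists_isCrossing hp
  exact ⟨_, toNilCoxeter_map_gen h⟩

variable (R n) in
/-- The functor from `NC(n)` to the atomic subcategory of the nilCoxeter algebroid. -/
def toAD : NC R n ⥤ AD R n := GeneratedSubcategory.lift (toNilCoxeter R n) toNilCoxeter_map_mem

instance : (toAD R n).Additive :=
  inferInstanceAs (GeneratedSubcategory.lift _ _).Additive

instance : (toAD R n).Linear R :=
  inferInstanceAs ((GeneratedSubcategory.lift _ _).Linear R)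

lemma toAD_obj_bijective : Function.Bijective (toAD R n).obj := by
  constructor
  · exact fun X Y h => toNilCoxeter_obj_bijective.1 (congrArg GeneratedSubcategory.obj h)
  · rintro ⟨A⟩
    obtain ⟨X, hX⟩ := toNilCoxeter_obj_bijective.2 A
    exact ⟨X, congrArg GeneratedSubcategory.mk hX⟩

lemma toAD_map_bijective (X Y : NC R n) :
    Function.Bijective fun f : X ⟶ Y => (toAD R n).map f := by
  constructor
  · exact fun f g h => (toNilCoxeter R n).map_injective (congrArg Subtype.val h)
  · rintro ⟨f, hf⟩
    obtain ⟨g, hg⟩ := GeneratedSubcategory.exists_map_eq_of_mem _ toNilCoxeter_obj_bijective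
      (fun _ => exists_map_eq_of_mem_atomicMorphisms) hf
    exact ⟨g, Subtype.ext hg⟩

lemma arrow_del_crossPerm {c d : Composition n} (h : IsCrossing i c d)
    (hi : i < (subsetOf c)ᶜ.card) :
    Arrow.mk (NilCoxeter.del R (Coset.mk (subsetOf d) (subsetOf c) (crossPerm c i))) =
      Arrow.mk (NilCoxeter.del R (atomicCoset (subsetOf c) ⟨i, hi⟩)) := by
  obtain ⟨P, a, b, A⟩ := h.exists_adjacentBlocks
  obtain ⟨_, hs⟩ := A.outer_subsetOf
  rw [atomicCoset, h.atomicTarget_subsetOf hi, atomicTop, A.mk_longest_insert h hs]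

end

end

end TypeA

theorem mainTheorem6 (R : Type u) [CommRing R] (n : ℕ) :
    ∃ ψ : TypeA.NC R n ⥤ TypeA.AD R n,
      ψ.Additive ∧ ψ.Linear R ∧
      Function.Bijective ψ.obj ∧
      (∀ X Y : TypeA.NC R n,
        Function.Bijective (fun f : X ⟶ Y => (ψ.map f : ψ.obj X ⟶ ψ.obj Y))) ∧
      (∀ c : Composition n, (ψ.obj (TypeA.NC.of R c)).obj.subset = TypeA.subsetOf c) ∧
      ∀ (c d : Composition n) (i : ℕ) (h : TypeA.IsCrossing i c d),
        ∃ hi : i < (TypeA.subsetOf c)ᶜ.card,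
          Arrow.mk ((GeneratedSubcategory.incl R (TypeA.atomicMorphisms R n)).map
              (ψ.map (TypeA.NC.del R i h))) =
            Arrow.mk (TypeA.NilCoxeter.del R (TypeA.atomicCoset (TypeA.subsetOf c) ⟨i, hi⟩)) := by
  refine ⟨TypeA.toAD R n, inferInstance, inferInstance, TypeA.toAD_obj_bijective,
    TypeA.toAD_map_bijective, fun _ => rfl, fun c d i h => ?_⟩
  obtain ⟨P, a, b, A⟩ := h.exists_adjacentBlocks
  obtain ⟨hi, -⟩ := A.outer_subsetOf
  exact ⟨hi, (congrArg Arrow.mk (TypeA.toNilCoxeter_map_gen (c := ⟨c⟩) (d := ⟨d⟩) h)).trans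
    (TypeA.arrow_del_crossPerm h hi)⟩
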